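/- Let $A$ be a ring with identity, let $\mathrm{Mod}\text{-}A$ be the category of right $A$-modules and $\mathrm{mod}\text{-}A$ its full subcategory of finitely presented modules. A full subcategory of $\mathrm{Mod}\text{-}A$ is called definable if it is closed under direct products, direct limits and pure subobjects. Let $\mathrm{mod}\text{-}(\mathrm{mod}\text{-}A)$ be the abelian category of finitely presented functors $F:\mathrm{mod}\text{-}A\to\mathrm{Ab}$, that is, functors admitting a sequence $\mathrm{Hom}_A(Y,-)\to\mathrm{Hom}_A(X,-)\to F\to 0$ with $X,Y\in\mathrm{mod}\text{-}A$ which is exact at every object; for such $F$ let $\overrightarrow{F}:\mathrm{Mod}\text{-}A\to\mathrm{Ab}$ be the unique extension of $F$ that commutes with direct limits, and let $\mathrm{Ker}(\overrightarrow F)=\{M\in\mathrm{Mod}\text{-}A\mid\overrightarrow F(M)=0\}$. Let $\mathbb{A}$ be the full subcategory of $\mathrm{mod}\text{-}A$ with objects $0,A,A^2,A^3,\dots$, and let $\mathrm{III}(\mathbb{A})$ be Adelman's abelian category over $\mathbb{A}$: its objects are the chains $X_1\xrightarrow{f_1}X_2\xrightarrow{f_2}X_3$ in $\mathbb{A}$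 (not necessarily complexes), and its morphisms from this chain to $Y_1\xrightarrow{g_1}Y_2\xrightarrow{g_2}Y_3$ are the commutative diagrams $(\alpha_1,\alpha_2,\alpha_3)$ modulo those for which $\alpha_2=g_1s+tf_2$ for some $s:X_2\to Y_1$ and $t:X_3\to Y_2$. For an object $\mathbf{A}=(A^n\xrightarrow{u}A^m\xrightarrow{v}A^p)$ of $\mathrm{III}(\mathbb{A})$ put $$\Omega_{\mathbf A}=\{M\in\mathrm{Mod}\text{-}A\mid \text{for every }\alpha:A^m\to M\text{ with }\alpha u=0\text{ there is }\beta:A^p\to M\text{ with }\alpha=\beta v\}.$$ A Serre subcategory of an abelian category is a full subcategory that contains the zero object and is closed under subobjects, quotients and extensions. Then: (1) For every Serre subcategory $\mathcal S$ of $\mathrm{mod}\text{-}(\mathrm{mod}\text{-}A)$ the subcategory $\bigcap_{F\in\mathcal S}\mathrm{Ker}(\overrightarrow F)$ of $\mathrm{Mod}\text{-}A$ is definable, and $\mathcal S\mapsto\bigcap_{F\in\mathcal S}\mathrm{Ker}(\overrightarrow F)$ is a bijection from the Serre subcategories of $\mathrm{mod}\text{-}(\mathrm{mod}\text{-}A)$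 onto the definable subcategories of $\mathrm{Mod}\text{-}A$. (2) For every Serre subcategory $\mathscr S$ of $\mathrm{III}(\mathbb{A})$ the subcategory $\bigcap_{\mathbf A\in\mathscr S}\Omega_{\mathbf A}$ of $\mathrm{Mod}\text{-}A$ is definable, and $\mathscr S\mapsto\bigcap_{\mathbf A\in\mathscr S}\Omega_{\mathbf A}$ is a bijection from the Serre subcategories of $\mathrm{III}(\mathbb{A})$ onto the definable subcategories of $\mathrm{Mod}\text{-}A$. (3) Both bijections reverse inclusions: for Serre subcategories $\mathcal S,\mathcal S'$ of the respective category, $\mathcal S\subseteq\mathcal S'$ if and only if the definable subcategory of $\mathcal S'$ is contained in that of $\mathcal S$. -/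

import Mathlib

open CategoryTheory CategoryTheory.Limits MulOpposite

universe u v

namespace FreeAb

/-! ### Modules -/

/-- `Mod-A`: right `A`-modules, that is, modules over `Aᵐᵒᵖ` (`op a • x` is `x a`). -/
abbrev RMod (A : Type u) [Ring A] : Type (u + 1) := ModuleCat.{u} Aᵐᵒᵖ

/-- The class of finitely presented right `A`-modules. -/
def isFinPres (A : Type u) [Ring A] : ObjectProperty (RMod A) :=
  fun M => Module.FinitePresentation Aᵐᵒᵖ M

/-- `mod-A`: the full subcategory of finitely presented right `A`-modules. -/
abbrev FPMod (A : Type u) [Ring A] : Type (u + 1) := (isFinPres A).FullSubcategory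

/-- A homomorphism `f : M ⟶ N` of right modules is a pure monomorphism if it is injective and
every finite system of linear equations `∑ i, yᵢ Uᵢⱼ = xⱼ` with constants `xⱼ` in `M` which has a
solution in `N` has a solution in `M`. -/
def IsPureMono {A : Type u} [Ring A] {M N : RMod A} (f : M ⟶ N) : Prop :=
  Function.Injective f ∧
    ∀ (m n : ℕ) (U : Matrix (Fin m) (Fin n) A) (x : Fin n → M),
      (∃ y : Fin m → N, ∀ j, ∑ i, op (U i j) • y i = f (x j)) →
        ∃ z : Fin m → M, ∀ j, ∑ i, op (U i j) • z i = x j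

/-- A (full) subcategory of `Mod-A` is definable if it is closed under direct products,
direct limits (colimits over non-empty directed posets) and pure subobjects. -/
structure IsDefinable {A : Type u} [Ring A] (D : ObjectProperty (RMod A)) : Prop where
  products : ∀ ι : Type u, D.IsClosedUnderLimitsOfShape (Discrete ι)
  directLimits : ∀ (J : Type u) [PartialOrder J] [IsDirectedOrder J] [Nonempty J],
    D.IsClosedUnderColimitsOfShape J
  pureSubobjects : ∀ {M N : RMod A} (f : M ⟶ N), IsPureMono f → D N → D M

/-! ### Serre subcategories -/

/-- A (full) subcategory is a Serre subcategory if it contains a zero object and is closed under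
subobjects, quotients and extensions. For an abelian category this is
`CategoryTheory.ObjectProperty.IsSerreClass`, see `isSerre_iff`. -/
structure IsSerre {C : Type u} [Category.{v} C] [HasZeroMorphisms C]
    (S : ObjectProperty C) : Prop where
  containsZero : S.ContainsZero
  subobjects : S.IsClosedUnderSubobjects
  quotients : S.IsClosedUnderQuotients
  extensions : S.IsClosedUnderExtensions

theorem isSerre_iff {C : Type u} [Category.{v} C] [Abelian C] (S : ObjectProperty C) :
    IsSerre S ↔ S.IsSerreClass :=
  ⟨fun h => { toContainsZero := h.1, toIsClosedUnderSubobjects := h.2,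
              toIsClosedUnderQuotients := h.3, toIsClosedUnderExtensions := h.4 },
    fun h => ⟨h.toContainsZero, h.toIsClosedUnderSubobjects, h.toIsClosedUnderQuotients,
      h.toIsClosedUnderExtensions⟩⟩

/-! ### Finitely presented functors on `mod-A` and their extensions to `Mod-A` -/

/-- A functor `F : mod-A ⥤ Ab` is finitely presented if there is a sequence
`Hom(Y, -) ⟶ Hom(X, -) ⟶ F ⟶ 0` with `X, Y` in `mod-A` which is exact at every object. -/
def isFinPresFunctor (A : Type u) [Ring A] : ObjectProperty (FPMod A ⥤ AddCommGrpCat.{u}) :=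
  fun F => ∃ (X Y : FPMod A)
    (φ : preadditiveCoyoneda.obj (Opposite.op Y) ⟶ preadditiveCoyoneda.obj (Opposite.op X))
    (π : preadditiveCoyoneda.obj (Opposite.op X) ⟶ F),
    ∀ Z : FPMod A, Function.Exact (φ.app Z) (π.app Z) ∧ Function.Surjective (π.app Z)

/-- `mod-(mod-A)`: the category of finitely presented functors `mod-A ⥤ Ab`. -/
abbrev FPFun (A : Type u) [Ring A] : Type (u + 1) := (isFinPresFunctor A).FullSubcategory

instance essentiallySmall_isFinPres (A : Type u) [Ring A] :
    ObjectProperty.EssentiallySmall.{u} (isFinPres A) where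
  exists_small_le' := by
    refine ⟨.ofObj (fun p : Σ n : ℕ, Submodule Aᵐᵒᵖ (Fin n → Aᵐᵒᵖ) =>
      ModuleCat.of Aᵐᵒᵖ ((Fin p.1 → Aᵐᵒᵖ) ⧸ p.2)), inferInstance, ?_⟩
    intro M hM
    have : Module.FinitePresentation Aᵐᵒᵖ M := hM
    obtain ⟨n, K, e, -⟩ := Module.FinitePresentation.exists_fin Aᵐᵒᵖ M
    exact ⟨_, ⟨⟨n, K⟩⟩, ⟨e.toModuleIso⟩⟩

instance hasPointwiseLeftKanExtension (A : Type u) [Ring A] (F : FPMod A ⥤ AddCommGrpCat.{u}) :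
    (isFinPres A).ι.HasPointwiseLeftKanExtension F := fun M => by
  have : EssentiallySmall.{u} (FPMod A) := inferInstance
  have := hasColimitsOfShape_of_essentiallySmall.{u} (CostructuredArrow (isFinPres A).ι M)
    AddCommGrpCat.{u}
  unfold Functor.HasPointwiseLeftKanExtensionAt
  infer_instance

/-- The extension of a functor `F : mod-A ⥤ Ab` to a functor `Mod-A ⥤ Ab` that commutes with
direct limits: the left Kan extension along `mod-A ⥤ Mod-A`. Its value at `M` is the direct limit
of the groups `F(X)` over all `X ⟶ M` with `X` in `mod-A`. -/
noncomputable def extend {A : Type u} [Ring A] (F : FPMod A ⥤ AddCommGrpCat.{u}) :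
    RMod A ⥤ AddCommGrpCat.{u} :=
  (isFinPres A).ι.leftKanExtension F

/-- The modules at which the extensions of all functors in `S` vanish. -/
def kerClass {A : Type u} [Ring A] (S : ObjectProperty (FPFun A)) : ObjectProperty (RMod A) :=
  fun M => ∀ F : FPFun A, S F → IsZero ((extend F.obj).obj M)

/-! ### Adelman's category of three-term chains up to homotopy -/

/-- A three-term chain `X₁ ⟶ X₂ ⟶ X₃` (not necessarily a complex). -/
structure Chain (C : Type u) [Category.{v} C] where
  X₁ : C
  X₂ : C
  X₃ : C
  f₁ : X₁ ⟶ X₂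
  f₂ : X₂ ⟶ X₃

namespace Chain

/-- A morphism of three-term chains. -/
@[ext]
structure Hom {C : Type u} [Category.{v} C] (X Y : Chain C) where
  α₁ : X.X₁ ⟶ Y.X₁
  α₂ : X.X₂ ⟶ Y.X₂
  α₃ : X.X₃ ⟶ Y.X₃
  comm₁ : α₁ ≫ Y.f₁ = X.f₁ ≫ α₂
  comm₂ : α₂ ≫ Y.f₂ = X.f₂ ≫ α₃

attribute [simp] Hom.comm₁ Hom.comm₂

instance {C : Type u} [Category.{v} C] : Category (Chain C) where
  Hom := Hom
  id X := ⟨𝟙 _, 𝟙 _, 𝟙 _, by simp, by simp⟩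
  comp {X Y Z} a b := ⟨a.α₁ ≫ b.α₁, a.α₂ ≫ b.α₂, a.α₃ ≫ b.α₃,
    by rw [Category.assoc, b.comm₁, ← Category.assoc, a.comm₁, Category.assoc],
    by rw [Category.assoc, b.comm₂, ← Category.assoc, a.comm₂, Category.assoc]⟩
  id_comp a := Hom.ext (Category.id_comp _) (Category.id_comp _) (Category.id_comp _)
  comp_id a := Hom.ext (Category.comp_id _) (Category.comp_id _) (Category.comp_id _)
  assoc a b c := Hom.ext (Category.assoc _ _ _) (Category.assoc _ _ _) (Category.assoc _ _ _)

theorem comp_α₂ {C : Type u} [Category.{v} C] {X Y Z : Chain C} (α : X ⟶ Y) (β : Y ⟶ Z) :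
    (α ≫ β).α₂ = α.α₂ ≫ β.α₂ := rfl

section Preadditive

variable {C : Type u} [Category.{v} C] [Preadditive C]

instance (X Y : Chain C) : Zero (X ⟶ Y) := ⟨⟨0, 0, 0, by simp, by simp⟩⟩

instance (X Y : Chain C) : Add (X ⟶ Y) :=
  ⟨fun a b => ⟨a.α₁ + b.α₁, a.α₂ + b.α₂, a.α₃ + b.α₃, by simp, by simp⟩⟩

instance (X Y : Chain C) : Neg (X ⟶ Y) :=
  ⟨fun a => ⟨-a.α₁, -a.α₂, -a.α₃, by simp, by simp⟩⟩

instance (X Y : Chain C) : AddCommGroup (X ⟶ Y) where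
  add_assoc a b c := Hom.ext (add_assoc _ _ _) (add_assoc _ _ _) (add_assoc _ _ _)
  zero_add a := Hom.ext (zero_add _) (zero_add _) (zero_add _)
  add_zero a := Hom.ext (add_zero _) (add_zero _) (add_zero _)
  add_comm a b := Hom.ext (add_comm _ _) (add_comm _ _) (add_comm _ _)
  neg_add_cancel a := Hom.ext (neg_add_cancel _) (neg_add_cancel _) (neg_add_cancel _)
  nsmul := nsmulRec
  zsmul := zsmulRec

instance : Preadditive (Chain C) where
  add_comp _ _ _ _ _ _ := Hom.ext (Preadditive.add_comp _ _ _ _ _ _)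
    (Preadditive.add_comp _ _ _ _ _ _) (Preadditive.add_comp _ _ _ _ _ _)
  comp_add _ _ _ _ _ _ := Hom.ext (Preadditive.comp_add _ _ _ _ _ _)
    (Preadditive.comp_add _ _ _ _ _ _) (Preadditive.comp_add _ _ _ _ _ _)

/-- `α` is null-homotopic if its middle component is `g₁ s + t f₂` for some `s`, `t`. -/
def NullHomotopic {X Y : Chain C} (α : X ⟶ Y) : Prop :=
  ∃ (s : X.X₂ ⟶ Y.X₁) (t : X.X₃ ⟶ Y.X₂), α.α₂ = s ≫ Y.f₁ + X.f₂ ≫ t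

variable (C) in
/-- Two parallel morphisms of chains are homotopic if their difference is null-homotopic. -/
def homotopic : HomRel (Chain C) := fun _ _ α β => NullHomotopic (α + -β)

theorem add_α₂ {X Y : Chain C} (α β : X ⟶ Y) : (α + β).α₂ = α.α₂ + β.α₂ := rfl

theorem neg_α₂ {X Y : Chain C} (α : X ⟶ Y) : (-α).α₂ = -α.α₂ := rfl

theorem homotopic_iff {X Y : Chain C} (α β : X ⟶ Y) :
    homotopic C α β ↔
      ∃ (s : X.X₂ ⟶ Y.X₁) (t : X.X₃ ⟶ Y.X₂), α.α₂ - β.α₂ = s ≫ Y.f₁ + X.f₂ ≫ t := by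
  simp only [homotopic, NullHomotopic, add_α₂, neg_α₂, sub_eq_add_neg]

instance : Congruence (homotopic C) where
  comp_left {X Y Z} f g g' h := by
    rw [homotopic_iff] at h ⊢
    obtain ⟨s, t, h⟩ := h
    refine ⟨f.α₂ ≫ s, f.α₃ ≫ t, ?_⟩
    rw [comp_α₂, comp_α₂, ← Preadditive.comp_sub, h, Preadditive.comp_add, Category.assoc,
      ← Category.assoc, ← Category.assoc, ← Category.assoc, f.comm₂]
  comp_right {X Y Z} f f' g h := by
    rw [homotopic_iff] at h ⊢
    obtain ⟨s, t, h⟩ := h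
    refine ⟨s ≫ g.α₁, t ≫ g.α₂, ?_⟩
    rw [comp_α₂, comp_α₂, ← Preadditive.sub_comp, h, Preadditive.add_comp, Category.assoc,
      Category.assoc, Category.assoc, g.comm₁]
  equivalence {X Y} :=
    { refl := fun a => (homotopic_iff a a).2 ⟨0, 0, by simp⟩
      symm := fun {a b} h => by
        rw [homotopic_iff] at h ⊢
        obtain ⟨s, t, h⟩ := h
        refine ⟨-s, -t, ?_⟩
        rw [← neg_sub, h]
        simp only [Preadditive.neg_comp, Preadditive.comp_neg]
        abel
      trans := fun {a b c} h h' => by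
        rw [homotopic_iff] at h h' ⊢
        obtain ⟨s, t, h⟩ := h
        obtain ⟨s', t', h'⟩ := h'
        refine ⟨s + s', t + t', ?_⟩
        rw [← sub_add_sub_cancel _ b.α₂, h, h']
        simp only [Preadditive.add_comp, Preadditive.comp_add]
        abel }

theorem homotopic_add ⦃X Y : Chain C⦄ (f₁ f₂ g₁ g₂ : X ⟶ Y) (h : homotopic C f₁ f₂)
    (h' : homotopic C g₁ g₂) : homotopic C (f₁ + g₁) (f₂ + g₂) := by
  rw [homotopic_iff] at h h' ⊢
  obtain ⟨s, t, h⟩ := h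
  obtain ⟨s', t', h'⟩ := h'
  refine ⟨s + s', t + t', ?_⟩
  rw [add_α₂, add_α₂, add_sub_add_comm, h, h']
  simp only [Preadditive.add_comp, Preadditive.comp_add]
  abel

end Preadditive

end Chain

/-- Adelman's category over `C`: three-term chains over `C` and
morphisms of chains modulo null-homotopic ones. -/
abbrev Adelman (C : Type u) [Category.{v} C] [Preadditive C] : Type (max u v) :=
  CategoryTheory.Quotient (Chain.homotopic C)

instance {C : Type u} [Category.{v} C] [Preadditive C] : Preadditive (Adelman C) :=
  CategoryTheory.Quotient.preadditive (Chain.homotopic C) Chain.homotopic_add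

/-- The right `A`-module `A^n`. -/
abbrev freeModule (A : Type u) [Ring A] (n : ℕ) : RMod A := ModuleCat.of Aᵐᵒᵖ (Fin n → A)

/-- The full subcategory `𝔸` of `mod-A` with objects `0, A, A², A³, …`. -/
abbrev FreeMod (A : Type u) [Ring A] : Type := InducedCategory (RMod A) (freeModule A)

/-- For `𝐀 = (A^n ⟶ A^m ⟶ A^p)` with maps `u`, `v`, the class `Ω_𝐀` of all right modules `M` such
that every `α : A^m ⟶ M` with `α u = 0` is of the form `β v` for some `β : A^p ⟶ M`. -/
def Omega {A : Type u} [Ring A] (T : Adelman (FreeMod A)) : ObjectProperty (RMod A) :=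
  fun M => ∀ α : freeModule A T.as.X₂ ⟶ M, T.as.f₁.hom ≫ α = 0 →
    ∃ β : freeModule A T.as.X₃ ⟶ M, α = T.as.f₂.hom ≫ β

/-- The intersection of the classes `Ω_𝐀` for `𝐀` in `S`. -/
def omegaClass {A : Type u} [Ring A] (S : ObjectProperty (Adelman (FreeMod A))) :
    ObjectProperty (RMod A) :=
  fun M => ∀ T : Adelman (FreeMod A), S T → Omega T M

end FreeAb

/-!
A finitely presented functor `F` is the cokernel of `Hom(f, -) : Hom(Y, -) ⟶ Hom(X, -)` for some
`f : X ⟶ Y` in `mod-A`, and `F⃗(M) = 0` if and only if every map `X ⟶ M` extends along `f`.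
Presenting `X` and `Y` by free modules turns extension problems along `f` into finite systems of
linear equations, so they are respected by pure subobjects and `Ker F⃗` is definable.

A Serre subcategory `S` is recovered from its class as follows. Embedding the quotient by `S` into
abelian groups (Freyd–Mitchell) gives an exact functor `E` on `mod-(mod-A)` that kills exactly `S`.
The contravariant functor `X ↦ E(Hom(X, -))` on `mod-A` is left exact, hence a filtered colimit of
representable functors `Hom(-, Z)`. If `M` is the colimit of these `Z` in `Mod-A`, this functor is
`Hom(-, M)`, and so `E(F) = 0` if and only if `F⃗(M) = 0`.

A definable `D` is recovered from its annihilator as follows. Let `M` satisfy every extension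
property that holds on `D`, and write `M` as a directed colimit of finitely presented modules `P_k`.
For each `k` there is `P_k ⟶ N_k` with `N_k ∈ D` such that `P_k ⟶ M` extends along every
`f : P_k ⟶ Q` along which `P_k ⟶ N_k` does. These maps induce a pure embedding of `M` into
`colim_j ∏_{k ≥ j} N_k`, which is in `D`.

For Adelman's category, send `(u, v)` to the functor presented by the morphism
`Coker u ⟶ Coker (v u)` induced by `v`. This is an equivalence of `III(𝔸)` with the opposite of
`mod-(mod-A)`, and `Ω_𝐀` is the class `Ker F⃗` of the functor `F` corresponding to `𝐀`.
-/

universe w w' v'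

namespace FreeAb

attribute [local instance] Cardinal.fact_isRegular_aleph0

section Modules

variable (A : Type u) [Ring A]

instance isClosedUnderIsomorphisms_isFinPres : (isFinPres A).IsClosedUnderIsomorphisms where
  of_iso e h :=
    have : Module.FinitePresentation Aᵐᵒᵖ _ := h
    Module.FinitePresentation.of_equiv e.toLinearEquiv

instance isClosedUnderCokernels_isFinPres : (isFinPres A).IsClosedUnderCokernels where
  cokernels_le := by
    rintro _ ⟨f, k, hk, hX, hY⟩
    have : Module.FinitePresentation Aᵐᵒᵖ _ := hX
    have : Module.FinitePresentation Aᵐᵒᵖ _ := hY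
    have := Module.finitePresentation_of_surjective (LinearMap.range f.hom).mkQ
      (Submodule.mkQ_surjective _) (by
        rw [Submodule.ker_mkQ]
        exact Module.Finite.iff_fg.1 (Module.Finite.range f.hom))
    exact (isFinPres A).prop_of_iso
      ((ModuleCat.cokernelIsColimit f).coconePointUniqueUpToIso hk) this

instance isClosedUnderFiniteProducts_isFinPres : (isFinPres A).IsClosedUnderFiniteProducts where
  isClosedUnderLimitsOfShape J _ := .mk' (by
    rintro _ ⟨F, hF⟩
    have (j : J) : Module.FinitePresentation Aᵐᵒᵖ (F.obj ⟨j⟩) := hF ⟨j⟩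
    have := Fintype.ofFinite J
    exact (isFinPres A).prop_of_iso
      ((ModuleCat.piIsoPi fun j => F.obj ⟨j⟩).symm ≪≫
        HasLimit.isoOfNatIso Discrete.natIsoFunctor.symm)
      (inferInstanceAs (Module.FinitePresentation Aᵐᵒᵖ (∀ j : J, F.obj ⟨j⟩))))

instance containsZero_isFinPres : (isFinPres A).ContainsZero where
  exists_zero :=
    ⟨ModuleCat.of Aᵐᵒᵖ PUnit, ModuleCat.isZero_of_subsingleton _,
      inferInstanceAs (Module.FinitePresentation Aᵐᵒᵖ PUnit.{u + 1})⟩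

instance : HasFiniteBiproducts (FPMod A) := .of_hasFiniteProducts

instance : HasBinaryBiproducts (FPMod A) := hasBinaryBiproducts_of_finite_biproducts _

instance : HasFiniteColimits (FPMod A) :=
  have : HasCoequalizers (FPMod A) := Preadditive.hasCoequalizers_of_hasCokernels
  hasFiniteColimits_of_hasCoequalizers_and_finite_coproducts

instance : PreservesFiniteColimits (isFinPres A).ι :=
  have := (isFinPres A).preservesCokernels_ι
  (isFinPres A).ι.preservesFiniteColimits_of_preservesCokernels

theorem isFinitelyPresentable_regular :
    IsFinitelyPresentable.{u} (ModuleCat.of Aᵐᵒᵖ Aᵐᵒᵖ) := by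
  rw [isFinitelyPresentable_iff_preservesFilteredColimits]
  let e : coyoneda.obj (Opposite.op (ModuleCat.of Aᵐᵒᵖ Aᵐᵒᵖ)) ≅ forget (RMod A) :=
    NatIso.ofComponents fun M =>
      (ModuleCat.homEquiv.trans (LinearMap.ringLmapEquivSelf Aᵐᵒᵖ ℕ M).toEquiv).toIso
  exact ⟨fun J _ _ => preservesColimitsOfShape_of_natIso e.symm⟩

theorem isStrongGenerator_regular :
    (ObjectProperty.singleton (ModuleCat.of Aᵐᵒᵖ Aᵐᵒᵖ)).IsStrongGenerator := by
  rw [ObjectProperty.isStrongGenerator_iff]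
  refine ⟨fun X Y f g h => ?_, fun X Y i _ h => ?_⟩
  · ext x
    simpa using ConcreteCategory.congr_hom
      (h _ ⟨⟨⟩⟩ (ModuleCat.ofHom (LinearMap.toSpanSingleton Aᵐᵒᵖ X x))) 1
  · have : Epi i := (ModuleCat.epi_iff_surjective i).2 fun y => by
      obtain ⟨f, hf⟩ := h _ ⟨⟨⟩⟩ (ModuleCat.ofHom (LinearMap.toSpanSingleton Aᵐᵒᵖ Y y))
      exact ⟨f 1, by simpa using ConcreteCategory.congr_hom hf 1⟩
    exact isIso_of_mono_of_epi i

theorem isFinPres_le_isFinitelyPresentable :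
    isFinPres A ≤ ObjectProperty.isFinitelyPresentable.{u} (RMod A) := by
  intro M hM
  let P := isCardinalPresentable (RMod A) Cardinal.aleph0.{u}
  have closed (J : Type) [SmallCategory J] [FinCategory J] : P.IsClosedUnderColimitsOfShape J :=
    isClosedUnderColimitsOfShape_isCardinalPresentable _ (hasCardinalLT_aleph0_iff _ |>.2
      inferInstance)
  have free (n : ℕ) : P (ModuleCat.of Aᵐᵒᵖ (Fin n → Aᵐᵒᵖ)) :=
    P.prop_of_iso (ModuleCat.biproductIsoPi fun _ : Fin n => ModuleCat.of Aᵐᵒᵖ Aᵐᵒᵖ)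
      (P.prop_of_isColimit (biproduct.isColimit _) fun _ => isFinitelyPresentable_regular A)
  have : Module.FinitePresentation Aᵐᵒᵖ M := hM
  obtain ⟨n, m, g, f, hg, hfg⟩ := Module.FinitePresentation.exists_fin' Aᵐᵒᵖ M
  refine P.prop_of_isColimit (ModuleCat.isColimitCokernelCofork (ModuleCat.ofHom f)
    (ModuleCat.ofHom g) hfg hg) ?_
  rintro (_ | _)
  exacts [free m, free n]

theorem isFinPres_eq_isFinitelyPresentable :
    isFinPres A = ObjectProperty.isFinitelyPresentable.{u} (RMod A) := by
  refine le_antisymm (isFinPres_le_isFinitelyPresentable A) ?_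
  have closed (J : Type u) [SmallCategory J] (hJ : HasCardinalLT (Arrow J) Cardinal.aleph0) :
      (isFinPres A).IsClosedUnderColimitsOfShape J := by
    obtain ⟨_⟩ := (Arrow.finite_iff J).1 ((hasCardinalLT_aleph0_iff _).1 hJ)
    exact (isFinPres A).isClosedUnderColimitsOfShape_of_preservesColimitsOfShape_ι J
  rw [ObjectProperty.isFinitelyPresentable_eq_isCardinalPresentable,
    IsStrongGenerator.colimitsCardinalClosure_eq_isCardinalPresentable
      (isStrongGenerator_regular A) (by rintro _ ⟨⟨⟩⟩; exact isFinitelyPresentable_regular A)]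
  refine ObjectProperty.colimitsCardinalClosure_le _ _ closed ?_
  rintro _ ⟨⟨⟩⟩
  exact inferInstanceAs (Module.FinitePresentation Aᵐᵒᵖ Aᵐᵒᵖ)

instance : IsFinitelyAccessibleCategory.{u} (RMod A) := by
  have := (IsCardinalLocallyPresentable.iff_exists_isStrongGenerator (RMod A) Cardinal.aleph0).2
    ⟨_, inferInstance, isStrongGenerator_regular A,
      by rintro _ ⟨⟨⟩⟩; exact isFinitelyPresentable_regular A⟩
  infer_instance

instance isFiltered_costructuredArrow (M : RMod A) :
    IsFiltered (CostructuredArrow (isFinPres A).ι M) := by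
  rw [isFinPres_eq_isFinitelyPresentable]
  infer_instance

instance : (isFinPres A).ι.IsDense := by
  rw [isFinPres_eq_isFinitelyPresentable]
  infer_instance

instance (X : FPMod A) : IsFinitelyPresentable.{u} X.obj :=
  isFinPres_le_isFinitelyPresentable A _ X.property

end Modules

section FreeModules

variable (A : Type u) [Ring A]

/-- The standard basis of the right module `A^n`. -/
noncomputable def freeBasis (n : ℕ) : Module.Basis (Fin n) Aᵐᵒᵖ (Fin n → A) :=
  .ofEquivFun (.piCongrRight fun _ => opLinearEquiv Aᵐᵒᵖ)

instance (n : ℕ) : Module.Free Aᵐᵒᵖ (Fin n → A) := .of_basis (freeBasis A n)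

instance (n : ℕ) : Module.FinitePresentation Aᵐᵒᵖ (Fin n → A) :=
  have : Module.Finite Aᵐᵒᵖ (Fin n → A) := .of_basis (freeBasis A n)
  Module.finitePresentation_of_projective _ _

instance (n : ℕ) : Projective (freeModule A n) :=
  (IsProjective.iff_projective (R := Aᵐᵒᵖ) (Fin n → A)).1 inferInstance

variable {A}

/-- The homomorphism `A^n ⟶ M` sending the standard basis to a given family. -/
noncomputable def freeLift {n : ℕ} {M : RMod A} : (Fin n → M) ≃ (freeModule A n ⟶ M) where
  toFun x := ModuleCat.ofHom ((freeBasis A n).constr ℕ x)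
  invFun f i := f (freeBasis A n i)
  left_inv x := funext ((freeBasis A n).constr_basis ℕ x)
  right_inv f := ModuleCat.hom_ext ((freeBasis A n).constr_self ℕ f.hom)

theorem freeLift_apply {n : ℕ} {M : RMod A} (x : Fin n → M) (c : Fin n → A) :
    freeLift x c = ∑ i, op (c i) • x i :=
  (freeBasis A n).constr_apply_fintype ℕ x c

theorem freeLift_comp {n : ℕ} {M N : RMod A} (x : Fin n → M) (f : M ⟶ N) :
    freeLift x ≫ f = freeLift (f ∘ x) :=
  freeLift.symm_apply_eq.1 <| funext fun i =>
    congrArg f (congrFun (freeLift.symm_apply_apply x) i)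

theorem freeLift_comp_freeLift_eq_iff {m n : ℕ} {M : RMod A} (U : Fin n → Fin m → A)
    (y : Fin m → M) (x : Fin n → M) :
    freeLift (M := freeModule A m) U ≫ freeLift y = freeLift x ↔
      ∀ j, ∑ i, op (U j i) • y i = x j := by
  rw [freeLift_comp, freeLift.apply_eq_iff_eq, funext_iff]
  exact forall_congr' fun j => by rw [← freeLift_apply y (U j)]; rfl

theorem exists_freeModule_epi (M : RMod A) [Module.Finite Aᵐᵒᵖ M] :
    ∃ (n : ℕ) (q : freeModule A n ⟶ M), Epi q := by
  obtain ⟨n, x, hx⟩ := Module.Finite.exists_fin (R := Aᵐᵒᵖ) (M := M)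
  exact ⟨n, freeLift x,
    (ModuleCat.epi_iff_range_eq_top _).2 (((freeBasis A n).constr_range ℕ).trans hx)⟩

theorem isPureMono_iff {M N : RMod A} (f : M ⟶ N) :
    IsPureMono f ↔ ∀ (m n : ℕ) (v : freeModule A n ⟶ freeModule A m) (α : freeModule A n ⟶ M)
      (β : freeModule A m ⟶ N), v ≫ β = α ≫ f → ∃ γ : freeModule A m ⟶ M, v ≫ γ = α := by
  simp only [freeLift.surjective.forall, freeLift.surjective.exists, freeLift_comp _ f,
    freeLift_comp_freeLift_eq_iff]
  refine ⟨fun h m n U x y hy => h.2 m n (fun i j => U j i) x ⟨y, hy⟩, fun h => ⟨?_, ?_⟩⟩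
  · refine (injective_iff_map_eq_zero f.hom).2 fun x hx => ?_
    obtain ⟨z, hz⟩ := h 0 1 0 (fun _ => x) 0 (by simpa using hx.symm)
    simpa using (hz 0).symm
  · exact fun m n U x ⟨y, hy⟩ => h m n (fun j i => U i j) x y hy

end FreeModules

section FunctorsToAb

variable {C : Type w} [Category.{v} C] {F G : C ⥤ AddCommGrpCat.{u}}

theorem mono_iff_app_injective (φ : F ⟶ G) :
    Mono φ ↔ ∀ Z, Function.Injective (φ.app Z) := by
  simp only [NatTrans.mono_iff_mono_app, AddCommGrpCat.mono_iff_injective]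

theorem epi_iff_app_surjective (φ : F ⟶ G) :
    Epi φ ↔ ∀ Z, Function.Surjective (φ.app Z) := by
  simp only [NatTrans.epi_iff_epi_app, AddCommGrpCat.epi_iff_surjective]

theorem exact_app {S : ShortComplex (C ⥤ AddCommGrpCat.{u})} (hS : S.Exact) (Z : C) :
    Function.Exact (S.f.app Z) (S.g.app Z) :=
  (ShortComplex.ab_exact_iff_function_exact _).1 (hS.map ((evaluation C AddCommGrpCat).obj Z))

end FunctorsToAb

section Presentations

variable {C : Type w} [Category.{v} C]

/-- The functor `F` is presented by `f : X ⟶ Y` with generic element `e ∈ F(X)`, that is, the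
sequence `Hom(Y, -) ⟶ Hom(X, -) ⟶ F ⟶ 0` given by `f` and (via Yoneda's lemma) `e` is exact. -/
structure Presents {X Y : C} (f : X ⟶ Y) (F : C ⥤ AddCommGrpCat.{u}) (e : F.obj X) : Prop where
  exists_map_eq : ∀ {Z : C} (z : F.obj Z), ∃ x : X ⟶ Z, F.map x e = z
  map_eq_zero_iff : ∀ {Z : C} {x : X ⟶ Z}, F.map x e = 0 ↔ ∃ t : Y ⟶ Z, f ≫ t = x

namespace Presents

variable {X Y : C} {f : X ⟶ Y} {F : C ⥤ AddCommGrpCat.{u}} {e : F.obj X}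

theorem map_eq_zero (h : Presents f F e) : F.map f e = 0 :=
  h.map_eq_zero_iff.2 ⟨𝟙 Y, Category.comp_id f⟩

theorem hom_ext (h : Presents f F e) {G : C ⥤ AddCommGrpCat.{u}} {φ ψ : F ⟶ G}
    (hφ : φ.app X e = ψ.app X e) : φ = ψ := by
  ext Z z
  obtain ⟨x, rfl⟩ := h.exists_map_eq z
  rw [NatTrans.naturality_apply, NatTrans.naturality_apply, hφ]

theorem isIso (h : Presents f F e) {G : C ⥤ AddCommGrpCat.{u}} (φ : F ⟶ G)
    (h' : Presents f G (φ.app X e)) : IsIso φ := by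
  have : Mono φ := (mono_iff_app_injective φ).2 fun Z => by
    rw [injective_iff_map_eq_zero]
    intro z hz
    obtain ⟨x, rfl⟩ := h.exists_map_eq z
    rwa [NatTrans.naturality_apply, h'.map_eq_zero_iff, ← h.map_eq_zero_iff] at hz
  have : Epi φ := (epi_iff_app_surjective φ).2 fun Z z => by
    obtain ⟨x, rfl⟩ := h'.exists_map_eq z
    exact ⟨F.map x e, NatTrans.naturality_apply φ x e⟩
  exact isIso_of_mono_of_epi φ

theorem map_eq_map_iff [Preadditive C] [F.Additive] (h : Presents f F e) {Z : C} {x x' : X ⟶ Z} :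
    F.map x e = F.map x' e ↔ ∃ t : Y ⟶ Z, x = x' + f ≫ t := by
  have : F.map (x - x') e = F.map x e - F.map x' e := by
    rw [F.map_sub]; rfl
  rw [← sub_eq_zero, ← this, h.map_eq_zero_iff]
  exact exists_congr fun t => by rw [eq_comm, sub_eq_iff_eq_add']

end Presents

variable [Preadditive C]

theorem presents_of_exact {X Y : C} {F : C ⥤ AddCommGrpCat.{v}}
    (φ : preadditiveCoyoneda.obj (.op Y) ⟶ preadditiveCoyoneda.obj (.op X))
    (π : preadditiveCoyoneda.obj (.op X) ⟶ F)
    (h : ∀ Z, Function.Exact (φ.app Z) (π.app Z) ∧ Function.Surjective (π.app Z)) :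
    Presents (φ.app Y (𝟙 Y)) F (π.app X (𝟙 X)) := by
  have hπ {Z : C} (x : X ⟶ Z) : F.map x (π.app X (𝟙 X)) = π.app Z x :=
    (NatTrans.naturality_apply π x (𝟙 X)).symm.trans (congrArg (π.app Z) (Category.id_comp x))
  have hφ {Z : C} (t : Y ⟶ Z) : φ.app Z t = φ.app Y (𝟙 Y) ≫ t :=
    (congrArg (φ.app Z) (Category.id_comp t).symm).trans (NatTrans.naturality_apply φ t (𝟙 Y))
  refine ⟨fun {Z} z => ?_, fun {Z} x => ?_⟩
  · obtain ⟨x, rfl⟩ := (h Z).2 z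
    exact ⟨x, hπ x⟩
  · rw [hπ]
    exact ((h Z).1 x).trans
      ⟨fun ⟨t, ht⟩ => ⟨t, (hφ t).symm.trans ht⟩, fun ⟨t, ht⟩ => ⟨t, (hφ t).trans ht⟩⟩

theorem additive_of_epi {F G : C ⥤ AddCommGrpCat.{u}} [F.Additive] (φ : F ⟶ G) [Epi φ] :
    G.Additive where
  map_add {X Y x y} := by
    ext z
    obtain ⟨z, rfl⟩ := (epi_iff_app_surjective φ).1 inferInstance X z
    change G.map (x + y) (φ.app X z) = G.map x (φ.app X z) + G.map y (φ.app X z)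
    simp only [← NatTrans.naturality_apply, ← map_add, F.map_add]
    rfl

theorem additive_of_mono {F G : C ⥤ AddCommGrpCat.{u}} [G.Additive] (φ : F ⟶ G) [Mono φ] :
    F.Additive where
  map_add {X Y x y} := by
    ext z
    refine (mono_iff_app_injective φ).1 inferInstance Y ?_
    change φ.app Y (F.map (x + y) z) = φ.app Y (F.map x z + F.map y z)
    simp only [map_add, NatTrans.naturality_apply, G.map_add]
    rfl

/-- The natural transformation corresponding to `e ∈ F(X)` under the additive Yoneda lemma. -/
def ofElement (F : C ⥤ AddCommGrpCat.{v}) [F.Additive] {X : C} (e : F.obj X) :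
    preadditiveCoyoneda.obj (.op X) ⟶ F where
  app Z := AddCommGrpCat.ofHom (AddMonoidHom.mk' (fun x : X ⟶ Z => F.map x e) fun x y =>
    congrArg (·.hom e) (F.map_add (f := x) (g := y)))
  naturality Z Z' g := by
    ext x
    exact ConcreteCategory.congr_hom (F.map_comp x g) e

/-- The cokernel of `Hom(f, -) : Hom(Y, -) ⟶ Hom(X, -)`. -/
noncomputable abbrev cokernelHom {X Y : C} (f : X ⟶ Y) : C ⥤ AddCommGrpCat.{v} :=
  cokernel (preadditiveCoyoneda.map f.op)

/-- The class of `𝟙 X` in the cokernel of `Hom(f, -)`. -/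
noncomputable def cokernelHomGen {X Y : C} (f : X ⟶ Y) : (cokernelHom f).obj X :=
  (cokernel.π (preadditiveCoyoneda.map f.op)).app X (𝟙 X)

theorem presents_cokernelHom {X Y : C} (f : X ⟶ Y) :
    Presents f (cokernelHom f) (cokernelHomGen f) := by
  have := presents_of_exact (preadditiveCoyoneda.map f.op) (cokernel.π _) fun Z =>
    ⟨exact_app (ShortComplex.exact_cokernel _) Z, (epi_iff_app_surjective _).1 inferInstance Z⟩
  rwa [show (preadditiveCoyoneda.map f.op).app Y (𝟙 Y) = f from Category.comp_id f] at this

instance additive_cokernelHom {X Y : C} (f : X ⟶ Y) : (cokernelHom f).Additive :=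
  additive_of_epi (cokernel.π (preadditiveCoyoneda.map f.op))

theorem Presents.nonempty_iso {X Y : C} {f : X ⟶ Y} {F : C ⥤ AddCommGrpCat.{v}} [F.Additive]
    {e : F.obj X} (h : Presents f F e) : Nonempty (cokernelHom f ≅ F) := by
  have hw : preadditiveCoyoneda.map f.op ≫ ofElement F e = 0 := by
    ext Z t
    exact h.map_eq_zero_iff.2 ⟨t, rfl⟩
  let φ : cokernelHom f ⟶ F := cokernel.desc _ (ofElement F e) hw
  have hφ : φ.app X (cokernelHomGen f) = e :=
    (congrArg (fun ψ => ψ.app X (𝟙 X)) (cokernel.π_desc _ _ hw)).trans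
      (ConcreteCategory.congr_hom (F.map_id X) e)
  have := (presents_cokernelHom f).isIso φ (hφ.symm ▸ h)
  exact ⟨asIso φ⟩

end Presentations

section FunctorCategory

variable {A : Type u} [Ring A]

theorem isFinPresFunctor_iff (F : FPMod A ⥤ AddCommGrpCat.{u}) :
    isFinPresFunctor A F ↔
      F.Additive ∧ ∃ (X Y : FPMod A) (f : X ⟶ Y) (e : F.obj X), Presents f F e := by
  refine ⟨fun ⟨X, Y, φ, π, h⟩ => ⟨?_, X, Y, _, _, presents_of_exact φ π h⟩,
    fun ⟨_, X, Y, f, e, h⟩ => ⟨X, Y, preadditiveCoyoneda.map f.op, ofElement F e, fun Z =>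
      ⟨fun _ => h.map_eq_zero_iff, h.exists_map_eq⟩⟩⟩
  have : Epi π := (epi_iff_app_surjective π).2 fun Z => (h Z).2
  exact additive_of_epi π

end FunctorCategory

section PresentationsClosure

variable {C : Type w} [Category.{v} C]

theorem Presents.exists_of_mono [HasPushouts C] {S : ShortComplex (C ⥤ AddCommGrpCat.{u})}
    (hS : S.Exact) [Mono S.f] {X Y X' Y' : C} {f : X ⟶ Y} {g : X' ⟶ Y'} {e : S.X₂.obj X}
    {e' : S.X₃.obj X'} (h : Presents f S.X₂ e) (h' : Presents g S.X₃ e') :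
    ∃ (P Q : C) (i : P ⟶ Q) (k : S.X₁.obj P), Presents i S.X₁ k := by
  have inj := (mono_iff_app_injective S.f).1 inferInstance
  obtain ⟨b, hb⟩ := h'.exists_map_eq (S.g.app X e)
  have hg {Z : C} (x : X ⟶ Z) : S.g.app Z (S.X₂.map x e) = S.X₃.map (b ≫ x) e' := by
    rw [NatTrans.naturality_apply, ← hb]
    exact (ConcreteCategory.congr_hom (S.X₃.map_comp b x) e').symm
  obtain ⟨k, hk⟩ := (exact_app hS _ (S.X₂.map (pushout.inl b g) e)).1
    ((hg _).trans (h'.map_eq_zero_iff.2 ⟨_, pushout.condition.symm⟩))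
  have hf {Z : C} (d : pushout b g ⟶ Z) :
      S.f.app Z (S.X₁.map d k) = S.X₂.map (pushout.inl b g ≫ d) e := by
    rw [NatTrans.naturality_apply, hk]
    exact (ConcreteCategory.congr_hom (S.X₂.map_comp _ d) e).symm
  refine ⟨_, _, pushout.inl (pushout.inl b g) f, k, fun {Z} z => ?_, fun {Z} d => ?_⟩
  · obtain ⟨x, hx⟩ := h.exists_map_eq (S.f.app Z z)
    obtain ⟨t, ht⟩ := h'.map_eq_zero_iff.1
      ((hg x).symm.trans ((exact_app hS Z _).2 ⟨z, hx.symm⟩))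
    refine ⟨pushout.desc x t ht.symm, inj Z ?_⟩
    rw [hf, pushout.inl_desc, hx]
  · rw [← (injective_iff_map_eq_zero' _).1 (inj Z), hf, h.map_eq_zero_iff]
    refine ⟨fun ⟨t, ht⟩ => ⟨pushout.desc d t ht.symm, pushout.inl_desc _ _ _⟩, fun ⟨t, ht⟩ =>
      ⟨pushout.inr (pushout.inl b g) f ≫ t, ?_⟩⟩
    rw [← ht, pushout.condition_assoc]

theorem biprod_app_ext {F G : C ⥤ AddCommGrpCat.{u}} {Z : C} {z z' : (F ⊞ G).obj Z}
    (h : (biprod.fst : F ⊞ G ⟶ F).app Z z = (biprod.fst : F ⊞ G ⟶ F).app Z z')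
    (h' : (biprod.snd : F ⊞ G ⟶ G).app Z z = (biprod.snd : F ⊞ G ⟶ G).app Z z') : z = z' := by
  have total (z : (F ⊞ G).obj Z) : (biprod.inl : F ⟶ F ⊞ G).app Z (biprod.fst (X := F).app Z z) +
      (biprod.inr : G ⟶ F ⊞ G).app Z (biprod.snd (X := F).app Z z) = z :=
    congrArg (fun φ => φ.app Z z) (biprod.total (X := F) (Y := G))
  rw [← total z, h, h', total]

theorem biprod_inl_app_add_inr_app_eq_zero_iff {F G : C ⥤ AddCommGrpCat.{u}} {Z : C}
    {a : F.obj Z} {b : G.obj Z} :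
    (biprod.inl : F ⟶ F ⊞ G).app Z a + (biprod.inr : G ⟶ F ⊞ G).app Z b = 0 ↔
      a = 0 ∧ b = 0 := by
  refine ⟨fun h => ⟨?_, ?_⟩, fun ⟨ha, hb⟩ => by rw [ha, hb, map_zero, map_zero, add_zero]⟩
  · have := congrArg ((biprod.fst : F ⊞ G ⟶ F).app Z) h
    simpa [← NatTrans.comp_app_apply] using this
  · have := congrArg ((biprod.snd : F ⊞ G ⟶ G).app Z) h
    simpa [← NatTrans.comp_app_apply] using this

variable [Preadditive C]

instance additive_biprod (F G : C ⥤ AddCommGrpCat.{u}) [F.Additive] [G.Additive] :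
    (F ⊞ G).Additive where
  map_add {X Y x y} := by
    ext z
    change (F ⊞ G).map (x + y) z = (F ⊞ G).map x z + (F ⊞ G).map y z
    refine biprod_app_ext ?_ ?_
    · simp only [map_add, NatTrans.naturality_apply, F.map_add]
      rfl
    · simp only [map_add, NatTrans.naturality_apply, G.map_add]
      rfl

theorem Presents.exists_of_epi [HasBinaryBiproducts C] {S : ShortComplex (C ⥤ AddCommGrpCat.{u})}
    (hS : S.Exact) [Epi S.g] [S.X₂.Additive] {X Y X' Y' : C} {f : X ⟶ Y} {g : X' ⟶ Y'}
    {e : S.X₁.obj X} {e' : S.X₂.obj X'} (h : Presents f S.X₁ e) (h' : Presents g S.X₂ e') :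
    ∃ (P Q : C) (i : P ⟶ Q) (k : S.X₃.obj P), Presents i S.X₃ k := by
  obtain ⟨b, hb⟩ := h'.exists_map_eq (S.f.app X e)
  have hf {Z : C} (x : X ⟶ Z) : S.f.app Z (S.X₁.map x e) = S.X₂.map (b ≫ x) e' := by
    rw [NatTrans.naturality_apply, ← hb]
    exact (ConcreteCategory.congr_hom (S.X₂.map_comp b x) e').symm
  refine ⟨X', X ⊞ Y', biprod.lift b g, S.g.app X' e', fun {Z} z => ?_, fun {Z} x => ?_⟩
  · obtain ⟨z, rfl⟩ := (epi_iff_app_surjective S.g).1 inferInstance Z z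
    obtain ⟨x, rfl⟩ := h'.exists_map_eq z
    exact ⟨x, (NatTrans.naturality_apply S.g x e').symm⟩
  · rw [← NatTrans.naturality_apply, exact_app hS Z]
    constructor
    · rintro ⟨w, hw⟩
      obtain ⟨y, rfl⟩ := h.exists_map_eq w
      obtain ⟨t, rfl⟩ := h'.map_eq_map_iff.1 (hw.symm.trans (hf y))
      exact ⟨biprod.desc y t, biprod.lift_desc⟩
    · rintro ⟨t, rfl⟩
      refine ⟨S.X₁.map (biprod.inl ≫ t) e, (hf _).trans (h'.map_eq_map_iff.2
        ⟨-(biprod.inr ≫ t), ?_⟩)⟩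
      rw [biprod.lift_eq]
      simp only [Preadditive.add_comp, Preadditive.comp_neg, Category.assoc]
      abel

theorem Presents.exists_biprod [HasBinaryBiproducts C] {F G : C ⥤ AddCommGrpCat.{u}}
    {X Y X' Y' : C} {f : X ⟶ Y} {g : X' ⟶ Y'} {e : F.obj X} {e' : G.obj X'}
    (h : Presents f F e) (h' : Presents g G e') :
    ∃ k, Presents (biprod.map f g) (F ⊞ G) k := by
  let k := (biprod.inl : F ⟶ F ⊞ G).app _ (F.map biprod.inl e) +
    (biprod.inr : G ⟶ F ⊞ G).app _ (G.map biprod.inr e')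
  have hk {Z : C} (x : X ⊞ X' ⟶ Z) : (F ⊞ G).map x k =
      (biprod.inl : F ⟶ F ⊞ G).app _ (F.map (biprod.inl ≫ x) e) +
        (biprod.inr : G ⟶ F ⊞ G).app _ (G.map (biprod.inr ≫ x) e') := by
    rw [map_add, ← NatTrans.naturality_apply, ← NatTrans.naturality_apply, F.map_comp, G.map_comp]
    rfl
  refine ⟨k, fun {Z} z => ?_, fun {Z} x => ?_⟩
  · obtain ⟨x, hx⟩ := h.exists_map_eq ((biprod.fst : F ⊞ G ⟶ F).app Z z)
    obtain ⟨y, hy⟩ := h'.exists_map_eq ((biprod.snd : F ⊞ G ⟶ G).app Z z)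
    refine ⟨biprod.desc x y, ?_⟩
    rw [hk, biprod.inl_desc, biprod.inr_desc, hx, hy]
    exact congrArg (fun φ => φ.app Z z) (biprod.total (X := F) (Y := G))
  · rw [hk, biprod_inl_app_add_inr_app_eq_zero_iff, h.map_eq_zero_iff, h'.map_eq_zero_iff]
    constructor
    · rintro ⟨⟨s, hs⟩, t, ht⟩
      exact ⟨biprod.desc s t, by ext <;> simp [hs, ht]⟩
    · rintro ⟨t, rfl⟩
      exact ⟨⟨biprod.inl ≫ t, by simp⟩, biprod.inr ≫ t, by simp⟩

end PresentationsClosure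

theorem Presents.of_iso {C : Type w} [Category.{v} C] {X Y : C} {f : X ⟶ Y}
    {F G : C ⥤ AddCommGrpCat.{u}} {e : F.obj X} (h : Presents f F e) (i : F ≅ G) :
    Presents f G (i.hom.app X e) where
  exists_map_eq {Z} z := by
    obtain ⟨z, rfl⟩ := (epi_iff_app_surjective i.hom).1 inferInstance Z z
    obtain ⟨x, rfl⟩ := h.exists_map_eq z
    exact ⟨x, (NatTrans.naturality_apply i.hom x e).symm⟩
  map_eq_zero_iff {Z x} := by
    rw [← NatTrans.naturality_apply, ← h.map_eq_zero_iff]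
    exact (injective_iff_map_eq_zero' _).1 ((mono_iff_app_injective i.hom).1 inferInstance Z) _

section AbelianFPFun

variable (A : Type u) [Ring A]

instance isClosedUnderKernels_isFinPresFunctor : (isFinPresFunctor A).IsClosedUnderKernels where
  kernels_le := by
    rintro _ ⟨φ, k, hk, hF, hG⟩
    rw [isFinPresFunctor_iff] at hF hG ⊢
    obtain ⟨_, _, _, _, _, h⟩ := hF
    obtain ⟨_, _, _, _, _, h'⟩ := hG
    have := mono_of_isLimit_fork hk
    exact ⟨additive_of_mono k.ι, Presents.exists_of_mono
      (ShortComplex.exact_of_f_is_kernel (.mk k.ι φ k.condition)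
        (hk.ofIsoLimit (Fork.isoForkOfι k))) h h'⟩

instance isClosedUnderCokernels_isFinPresFunctor :
    (isFinPresFunctor A).IsClosedUnderCokernels where
  cokernels_le := by
    rintro _ ⟨φ, k, hk, hF, hG⟩
    rw [isFinPresFunctor_iff] at hF hG ⊢
    obtain ⟨_, _, _, _, _, h⟩ := hF
    obtain ⟨_, _, _, _, _, h'⟩ := hG
    have := epi_of_isColimit_cofork hk
    exact ⟨additive_of_epi k.π, Presents.exists_of_epi
      (ShortComplex.exact_of_g_is_cokernel (.mk φ k.π k.condition)
        (hk.ofIsoColimit (Cofork.isoCoforkOfπ k))) h h'⟩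

instance isClosedUnderIsomorphisms_isFinPresFunctor :
    (isFinPresFunctor A).IsClosedUnderIsomorphisms where
  of_iso := by
    rintro F G i hF
    obtain ⟨_, X, Y, f, e, h⟩ := (isFinPresFunctor_iff F).1 hF
    exact (isFinPresFunctor_iff G).2 ⟨Functor.additive_of_iso i, X, Y, f, _, h.of_iso i⟩

theorem isFinPresFunctor_of_isZero {F : FPMod A ⥤ AddCommGrpCat.{u}} (hF : IsZero F) :
    isFinPresFunctor A F := by
  have hadd : F.Additive := ⟨(hF.obj _).eq_of_src _ _⟩
  obtain ⟨X⟩ : Nonempty (FPMod A) := inferInstance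
  have (Z : FPMod A) : Subsingleton (F.obj Z) := AddCommGrpCat.subsingleton_of_isZero (hF.obj Z)
  exact (isFinPresFunctor_iff F).2 ⟨hadd, X, X, 𝟙 X, 0,
    ⟨fun _ => ⟨0, Subsingleton.elim _ _⟩, iff_of_true (map_zero _) ⟨_, Category.id_comp _⟩⟩⟩

instance isClosedUnderFiniteProducts_isFinPresFunctor :
    (isFinPresFunctor A).IsClosedUnderFiniteProducts := by
  have : (isFinPresFunctor A).IsClosedUnderLimitsOfShape (Discrete.{0} PEmpty) :=
    .mk' (by
      rintro _ ⟨K, -⟩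
      exact isFinPresFunctor_of_isZero A
        ((IsZero.iff_id_eq_zero _).2 (limit.hom_ext fun j => j.as.elim)))
  have : (isFinPresFunctor A).IsClosedUnderBinaryProducts := .mk' (by
    rintro _ ⟨K, hK⟩
    obtain ⟨_, _, _, _, _, h⟩ := (isFinPresFunctor_iff _).1 (hK ⟨.left⟩)
    obtain ⟨_, _, _, _, _, h'⟩ := (isFinPresFunctor_iff _).1 (hK ⟨.right⟩)
    obtain ⟨_, h⟩ := h.exists_biprod h'
    have := (isFinPresFunctor_iff _).2 ⟨inferInstance, _, _, _, _, h⟩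
    exact (isFinPresFunctor A).prop_of_iso
      (biprod.isoProd _ _ ≪≫ HasLimit.isoOfNatIso (diagramIsoPair K).symm) this)
  exact .mk'

theorem isFinPresFunctor_cokernelHom {X Y : FPMod A} (f : X ⟶ Y) :
    isFinPresFunctor A (cokernelHom f) :=
  (isFinPresFunctor_iff _).2 ⟨inferInstance, X, Y, f, _, presents_cokernelHom f⟩

instance containsZero_isFinPresFunctor : (isFinPresFunctor A).ContainsZero where
  exists_zero := ⟨_, isZero_zero _, isFinPresFunctor_of_isZero A (isZero_zero _)⟩

instance preservesHomology_ι_isFinPresFunctor : (isFinPresFunctor A).ι.PreservesHomology where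
  preservesKernels _ _ φ := (isFinPresFunctor A).preservesKernels_ι φ
  preservesCokernels _ _ φ := (isFinPresFunctor A).preservesCokernels_ι φ

end AbelianFPFun

section Vanishing

variable {A : Type u} [Ring A]

/-- `F⃗(M) = 0` expressed by elements, see `isZero_extend_iff`: every element of `F(X)`, for a map
`X ⟶ M` with `X` finitely presented, is killed by some factorization `X ⟶ Y ⟶ M`. -/
def Vanishes (F : FPMod A ⥤ AddCommGrpCat.{u}) (M : RMod A) : Prop :=
  ∀ (X : FPMod A) (g : X.obj ⟶ M) (x : F.obj X),
    ∃ (Y : FPMod A) (h : X ⟶ Y) (k : Y.obj ⟶ M), h.hom ≫ k = g ∧ F.map h x = 0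

theorem isZero_extend_iff (F : FPMod A ⥤ AddCommGrpCat.{u}) (M : RMod A) :
    IsZero ((extend F).obj M) ↔ Vanishes F M := by
  have : EssentiallySmall.{u} (FPMod A) := inferInstance
  have : EssentiallySmall.{u} (CostructuredArrow (isFinPres A).ι M) := inferInstance
  let e := equivSmallModel.{u} (CostructuredArrow (isFinPres A).ι M)
  have : IsFiltered (SmallModel.{u} (CostructuredArrow (isFinPres A).ι M)) :=
    IsFiltered.of_equivalence e
  have : PreservesColimitsOfShape (CostructuredArrow (isFinPres A).ι M)
      (forget AddCommGrpCat.{u}) := preservesColimitsOfShape_of_equiv e.symm _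
  have hc := (isFinPres A).ι.isPointwiseLeftKanExtensionLeftKanExtensionUnit F M
  constructor
  · intro h X g x
    have : Subsingleton ((extend F).obj M) := AddCommGrpCat.subsingleton_of_isZero h
    obtain ⟨j, f, hf⟩ := (hc.eq_iff' (i := CostructuredArrow.mk (Y := X) g) x 0).1
      (Subsingleton.elim (α := (extend F).obj M) _ _)
    exact ⟨j.left, f.left, j.hom, CostructuredArrow.w f, hf.trans (map_zero _)⟩
  · intro h
    have : Subsingleton ((extend F).obj M) := by
      refine subsingleton_of_forall_eq 0 fun y => ?_
      obtain ⟨j, x, rfl⟩ := Concrete.isColimit_exists_rep _ hc y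
      obtain ⟨Y, c, k, hk, hx⟩ := h j.left j.hom x
      have := (hc.eq_iff' (i := j) x 0).2
        ⟨CostructuredArrow.mk (Y := Y) k, CostructuredArrow.homMk c hk,
          hx.trans (map_zero _).symm⟩
      exact this.trans (map_zero _)
    exact AddCommGrpCat.isZero_of_subsingleton _

variable {M : RMod A}

theorem Vanishes.of_mono {F G : FPMod A ⥤ AddCommGrpCat.{u}} (φ : F ⟶ G) [Mono φ]
    (h : Vanishes G M) : Vanishes F M := by
  intro X g x
  obtain ⟨Y, c, k, hk, hx⟩ := h X g (φ.app X x)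
  rw [← NatTrans.naturality_apply] at hx
  exact ⟨Y, c, k, hk, (injective_iff_map_eq_zero _).1
    ((mono_iff_app_injective φ).1 inferInstance Y) _ hx⟩

theorem Vanishes.of_epi {F G : FPMod A ⥤ AddCommGrpCat.{u}} (φ : F ⟶ G) [Epi φ]
    (h : Vanishes F M) : Vanishes G M := by
  intro X g x
  obtain ⟨x, rfl⟩ := (epi_iff_app_surjective φ).1 inferInstance X x
  obtain ⟨Y, c, k, hk, hx⟩ := h X g x
  exact ⟨Y, c, k, hk, by rw [← NatTrans.naturality_apply, hx, map_zero]⟩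

theorem Vanishes.of_exact {S : ShortComplex (FPMod A ⥤ AddCommGrpCat.{u})} (hS : S.Exact)
    (h₁ : Vanishes S.X₁ M) (h₃ : Vanishes S.X₃ M) : Vanishes S.X₂ M := by
  intro X g x
  obtain ⟨Y, c, k, rfl, hx⟩ := h₃ X g (S.g.app X x)
  rw [← NatTrans.naturality_apply, exact_app hS Y] at hx
  obtain ⟨y, hy⟩ := hx
  obtain ⟨Z, d, l, rfl, hy'⟩ := h₁ Y k y
  refine ⟨Z, c ≫ d, l, Category.assoc _ _ _, ?_⟩
  calc S.X₂.map (c ≫ d) x = S.X₂.map d (S.X₂.map c x) :=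
        ConcreteCategory.congr_hom (S.X₂.map_comp c d) x
    _ = 0 := by rw [← hy, ← NatTrans.naturality_apply, hy', map_zero]

/-- The functors whose extensions to `Mod-A` vanish on `D`. -/
def annihilator (D : ObjectProperty (RMod A)) : ObjectProperty (FPFun A) :=
  fun F => ∀ M, D M → Vanishes F.obj M

theorem vanishes_of_isZero {F : FPMod A ⥤ AddCommGrpCat.{u}} (hF : IsZero F) : Vanishes F M :=
  fun X g _ => ⟨X, 𝟙 X, g, Category.id_comp g,
    have := AddCommGrpCat.subsingleton_of_isZero (hF.obj X)
    Subsingleton.elim _ _⟩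

theorem isSerre_annihilator (D : ObjectProperty (RMod A)) : IsSerre (annihilator D) where
  containsZero := ⟨_, isZero_zero _, fun _ _ =>
    vanishes_of_isZero ((isFinPresFunctor A).ι.map_isZero (isZero_zero _))⟩
  subobjects := ⟨fun φ _ h M hM => (h M hM).of_mono ((isFinPresFunctor A).ι.map φ)⟩
  quotients := ⟨fun φ _ h M hM => (h M hM).of_epi ((isFinPresFunctor A).ι.map φ)⟩
  extensions := ⟨fun hS h₁ h₃ M hM =>
    Vanishes.of_exact (hS.exact.map (isFinPresFunctor A).ι) (h₁ M hM) (h₃ M hM)⟩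

theorem kerClass_iff {S : ObjectProperty (FPFun A)} :
    kerClass S M ↔ ∀ F, S F → Vanishes F.obj M :=
  forall₂_congr fun F _ => isZero_extend_iff F.obj M

end Vanishing

/-- The objects `M` such that every map `X ⟶ M` extends along `f : X ⟶ Y`. -/
def InjectiveAlong {C : Type w} [Category.{v} C] {X Y : C} (f : X ⟶ Y) : ObjectProperty C :=
  fun M => ∀ g : X ⟶ M, ∃ h : Y ⟶ M, f ≫ h = g

theorem Presents.vanishes_iff {A : Type u} [Ring A] {X Y : FPMod A} {f : X ⟶ Y}
    {F : FPMod A ⥤ AddCommGrpCat.{u}} {e : F.obj X} (h : Presents f F e) {M : RMod A} :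
    Vanishes F M ↔ InjectiveAlong f.hom M := by
  constructor
  · intro hF g
    obtain ⟨Z, c, k, rfl, hc⟩ := hF X g e
    obtain ⟨t, rfl⟩ := h.map_eq_zero_iff.1 hc
    exact ⟨t.hom ≫ k, (Category.assoc _ _ _).symm⟩
  · intro hf Z g z
    obtain ⟨x, rfl⟩ := h.exists_map_eq z
    obtain ⟨y, hy⟩ := hf (x.hom ≫ g)
    have sq := (IsPushout.of_hasPushout x f).map (isFinPres A).ι
    exact ⟨_, pushout.inl x f, sq.desc g y hy.symm, sq.inl_desc _ _ _,
      (ConcreteCategory.congr_hom (F.map_comp x _) e).symm.trans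
        (h.map_eq_zero_iff.2 ⟨_, pushout.condition.symm⟩)⟩

theorem isPushout_of_exact {C : Type w} [Category.{v} C] [Abelian C] {K L P X Q Y : C} {c : K ⟶ Q}
    {q : Q ⟶ Y} {hc : c ≫ q = 0} (hcq : (ShortComplex.mk c q hc).Exact) [Epi q] {b : P ⟶ Q}
    {a : P ⟶ X} [Epi a] {f : X ⟶ Y} (hb : b ≫ q = a ≫ f) (e : L ⟶ P ⊞ K) [Epi e] :
    IsPushout (e ≫ biprod.desc b c) (e ≫ biprod.desc a 0) q f := by
  have w : biprod.desc b c ≫ q = biprod.desc a 0 ≫ f :=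
    biprod.hom_ext' _ _ (by simp [hb]) (by simp [hc])
  have hs (s : PushoutCocone (e ≫ biprod.desc b c) (e ≫ biprod.desc a 0)) :
      b ≫ s.inl = a ≫ s.inr ∧ c ≫ s.inl = 0 := by
    have := s.condition
    rw [Category.assoc, Category.assoc, cancel_epi] at this
    exact ⟨by simpa using biprod.inl ≫= this, by simpa using biprod.inr ≫= this⟩
  let d (s : PushoutCocone (e ≫ biprod.desc b c) (e ≫ biprod.desc a 0)) : Y ⟶ s.pt :=
    hcq.desc s.inl (hs s).2
  have hd (s) : q ≫ d s = s.inl := hcq.g_desc _ _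
  refine ⟨⟨by simp only [Category.assoc, w]⟩, ⟨PushoutCocone.IsColimit.mk _ d hd (fun s => ?_)
    fun s d' hd' _ => ?_⟩⟩
  · rw [← cancel_epi a, ← reassoc_of% hb, hd, (hs s).1]
  · rw [← cancel_epi q, hd', hd]

section FreePresentations

variable {A : Type u} [Ring A]

theorem exists_freeModule_exact {P Y : RMod A} (q : P ⟶ Y) [Epi q] [Module.Finite Aᵐᵒᵖ P]
    [Module.FinitePresentation Aᵐᵒᵖ Y] :
    ∃ (n : ℕ) (u : freeModule A n ⟶ P) (w : u ≫ q = 0), (ShortComplex.mk u q w).Exact := by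
  have : Module.Finite Aᵐᵒᵖ (LinearMap.ker q.hom) := .of_fg <|
    Module.FinitePresentation.fg_ker q.hom ((ModuleCat.epi_iff_surjective q).1 inferInstance)
  obtain ⟨n, c, hc⟩ := exists_freeModule_epi (ModuleCat.of Aᵐᵒᵖ (LinearMap.ker q.hom))
  refine ⟨n, c ≫ ModuleCat.ofHom (LinearMap.ker q.hom).subtype, ?_,
    (ShortComplex.moduleCat_exact_iff _).2 fun x hx => ?_⟩
  · exact ModuleCat.hom_ext (LinearMap.ext fun x => (c x).2)
  · obtain ⟨y, hy⟩ := (ModuleCat.epi_iff_surjective c).1 hc ⟨x, hx⟩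
    exact ⟨y, congrArg Subtype.val hy⟩

theorem exists_isPushout_freeModule {X Y : RMod A} (f : X ⟶ Y) [Module.Finite Aᵐᵒᵖ X]
    [Module.FinitePresentation Aᵐᵒᵖ Y] :
    ∃ (m p : ℕ) (v : freeModule A m ⟶ freeModule A p) (a : freeModule A m ⟶ X)
      (q : freeModule A p ⟶ Y), Epi a ∧ IsPushout v a q f := by
  obtain ⟨l, a, _⟩ := exists_freeModule_epi X
  obtain ⟨p, q, _⟩ := exists_freeModule_epi Y
  obtain ⟨k, c, _, hcq⟩ := exists_freeModule_exact q
  let b : freeModule A l ⟶ freeModule A p := Projective.factorThru (a ≫ f) q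
  have hb : b ≫ q = a ≫ f := Projective.factorThru_comp _ _
  have : Module.Finite Aᵐᵒᵖ ↑(freeModule A l ⊞ freeModule A k) :=
    Module.Finite.equiv (ModuleCat.biprodIsoProd _ _).symm.toLinearEquiv
  obtain ⟨m, e, _⟩ := exists_freeModule_epi (freeModule A l ⊞ freeModule A k)
  have : Epi (biprod.desc a (0 : freeModule A k ⟶ X)) := epi_of_epi_fac (biprod.inl_desc a 0)
  exact ⟨m, p, _, e ≫ biprod.desc a 0, q, epi_comp _ _, isPushout_of_exact hcq hb e⟩

theorem IsPureMono.exists_lift {M N : RMod A} {ι : M ⟶ N} (hι : IsPureMono ι) {X Y : RMod A}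
    (f : X ⟶ Y) [Module.Finite Aᵐᵒᵖ X] [Module.FinitePresentation Aᵐᵒᵖ Y] {g : X ⟶ M} {h : Y ⟶ N}
    (w : f ≫ h = g ≫ ι) : ∃ k : Y ⟶ M, f ≫ k = g := by
  obtain ⟨m, p, v, a, q, _, sq⟩ := exists_isPushout_freeModule f
  obtain ⟨γ, hγ⟩ := (isPureMono_iff ι).1 hι p m v (a ≫ g) (q ≫ h) (by
    rw [sq.w_assoc, w, Category.assoc])
  exact ⟨sq.desc γ g hγ, sq.inr_desc _ _ _⟩

end FreePresentations

section Definable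

variable {C : Type w} [Category.{v} C] {X Y : C} (f : X ⟶ Y)

theorem InjectiveAlong.of_isLimit_discrete {J : Type*} {K : Discrete J ⥤ C} {c : Cone K}
    (hc : IsLimit c) (h : ∀ j, InjectiveAlong f (K.obj ⟨j⟩)) : InjectiveAlong f c.pt := fun g => by
  choose y hy using fun j => h j (g ≫ c.π.app ⟨j⟩)
  refine ⟨hc.lift ⟨Y, Discrete.natTrans fun j => y j.as⟩, hc.hom_ext fun ⟨j⟩ => ?_⟩
  rw [Category.assoc, hc.fac]
  exact hy j

theorem InjectiveAlong.of_isColimit [IsFinitelyPresentable.{u} X] {J : Type u} [SmallCategory J]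
    [IsFiltered J] {K : J ⥤ C} {c : Cocone K} (hc : IsColimit c)
    (h : ∀ j, InjectiveAlong f (K.obj j)) : InjectiveAlong f c.pt := fun g => by
  obtain ⟨j, g, rfl⟩ := IsFinitelyPresentable.exists_hom_of_isColimit hc g
  obtain ⟨y, rfl⟩ := h j g
  exact ⟨y ≫ c.ι.app j, (Category.assoc _ _ _).symm⟩

variable {A : Type u} [Ring A]

theorem isDefinable_injectiveAlong {X Y : FPMod A} (f : X ⟶ Y) :
    IsDefinable (InjectiveAlong f.hom) where
  products ι := ⟨fun _ ⟨p⟩ => .of_isLimit_discrete _ p.isLimit fun j => p.prop_diag_obj ⟨j⟩⟩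
  directLimits J := ⟨fun _ ⟨p⟩ => .of_isColimit _ p.isColimit p.prop_diag_obj⟩
  pureSubobjects ι hι hN g := by
    have : Module.FinitePresentation Aᵐᵒᵖ X.obj := X.property
    have : Module.FinitePresentation Aᵐᵒᵖ Y.obj := Y.property
    obtain ⟨h, hh⟩ := hN (g ≫ ι)
    exact hι.exists_lift f.hom hh

end Definable

section ArrowFunctor

theorem Presents.exists_hom {C : Type w} [Category.{v} C] {X Y X' Y' : C} {f : X ⟶ Y} {g : X' ⟶ Y'}
    {F G : C ⥤ AddCommGrpCat.{u}} {e : F.obj X} {e' : G.obj X'} (h : Presents f F e)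
    (h' : Presents g G e') (φ : F ⟶ G) :
    ∃ (a : X' ⟶ X) (b : Y' ⟶ Y), a ≫ f = g ≫ b ∧ G.map a e' = φ.app X e := by
  obtain ⟨a, ha⟩ := h'.exists_map_eq (φ.app X e)
  have hf : G.map (a ≫ f) e' = 0 :=
    calc G.map (a ≫ f) e' = G.map f (G.map a e') := ConcreteCategory.congr_hom (G.map_comp a f) e'
      _ = φ.app Y (F.map f e) := by rw [ha, NatTrans.naturality_apply]
      _ = 0 := by rw [h.map_eq_zero, map_zero]
  obtain ⟨b, hb⟩ := h'.map_eq_zero_iff.1 hf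
  exact ⟨a, b, hb.symm, ha⟩

variable (C : Type w) [Category.{v} C] [Preadditive C]

/-- The functor sending an arrow `f` to the functor `cokernelHom f` presented by it. -/
noncomputable def cokernelHomFunctor : (Arrow C)ᵒᵖ ⥤ C ⥤ AddCommGrpCat.{v} where
  obj f := cokernelHom f.unop.hom
  map {f g} s := cokernel.map _ _ (preadditiveCoyoneda.map s.unop.right.op)
    (preadditiveCoyoneda.map s.unop.left.op) (by
      rw [← Functor.map_comp, ← Functor.map_comp, ← op_comp, ← op_comp, Arrow.w])
  map_id f := by
    rw [← cancel_epi (cokernel.π _)]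
    simp
  map_comp s t := by
    rw [← cancel_epi (cokernel.π _)]
    simp

variable {C}

theorem cokernelHomFunctor_map_app {f g : Arrow C} (s : f ⟶ g) :
    ((cokernelHomFunctor C).map s.op).app g.left (cokernelHomGen g.hom) =
      (cokernelHom f.hom).map s.left (cokernelHomGen f.hom) := by
  have hs : cokernel.π (preadditiveCoyoneda.map g.hom.op) ≫ (cokernelHomFunctor C).map s.op =
      preadditiveCoyoneda.map s.left.op ≫ cokernel.π (preadditiveCoyoneda.map f.hom.op) :=
    cokernel.π_desc _ _ _
  have hf := NatTrans.naturality_apply (cokernel.π (preadditiveCoyoneda.map f.hom.op)) s.left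
    (𝟙 f.left)
  refine (congrArg (fun φ => φ.app g.left (𝟙 g.left)) hs).trans (Eq.trans ?_ hf)
  exact congrArg ((cokernel.π (preadditiveCoyoneda.map f.hom.op)).app g.left)
    ((Category.comp_id s.left).trans (Category.id_comp s.left).symm)

theorem cokernelHomFunctor_map_eq_iff {f g : Arrow C} (s t : f ⟶ g) :
    (cokernelHomFunctor C).map s.op = (cokernelHomFunctor C).map t.op ↔
      ∃ d : f.right ⟶ g.left, s.left = t.left + f.hom ≫ d := by
  rw [← (presents_cokernelHom f.hom).map_eq_map_iff, ← cokernelHomFunctor_map_app,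
    ← cokernelHomFunctor_map_app]
  exact ⟨fun h => by rw [h], (presents_cokernelHom g.hom).hom_ext⟩

instance : (cokernelHomFunctor C).Full where
  map_surjective {f g} φ := by
    obtain ⟨a, b, hab, ha⟩ := (presents_cokernelHom f.unop.hom).exists_hom
      (presents_cokernelHom g.unop.hom) φ
    exact ⟨(Arrow.homMk a b hab).op, (presents_cokernelHom f.unop.hom).hom_ext
      ((cokernelHomFunctor_map_app (Arrow.homMk a b hab)).trans ha)⟩

end ArrowFunctor

section Projectives

variable {C : Type w} [Category.{v} C] [Abelian C] {X₁ X₂ X₃ Y₁ Y₂ Y₃ : C}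

/-- The morphism `Coker f ⟶ Coker (g f)` induced by `g`. -/
noncomputable abbrev cokernelToComp (f : X₁ ⟶ X₂) (g : X₂ ⟶ X₃) : cokernel f ⟶ cokernel (f ≫ g) :=
  cokernel.map _ _ (𝟙 _) g (Category.id_comp _).symm

theorem injectiveAlong_cokernelToComp_iff {f : X₁ ⟶ X₂} {g : X₂ ⟶ X₃} {M : C} :
    InjectiveAlong (cokernelToComp f g) M ↔
      ∀ α : X₂ ⟶ M, f ≫ α = 0 → ∃ β : X₃ ⟶ M, α = g ≫ β := by
  constructor
  · intro h α hα
    obtain ⟨k, hk⟩ := h (cokernel.desc f α hα)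
    refine ⟨cokernel.π _ ≫ k, ?_⟩
    rw [← cokernel.π_desc f α hα, ← hk, cokernel.π_desc_assoc, Category.assoc]
  · intro h k
    obtain ⟨β, hβ⟩ := h (cokernel.π f ≫ k) (by simp)
    have hβ' : (f ≫ g) ≫ β = 0 := by
      rw [Category.assoc, ← hβ, cokernel.condition_assoc, zero_comp]
    exact ⟨cokernel.desc _ β hβ', (cancel_epi (cokernel.π f)).1 (by simp [hβ])⟩

theorem cokernel_map_comp_cokernel_map {X X' X'' Y Y' Y'' : C} {f : X ⟶ Y} {f' : X' ⟶ Y'}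
    {f'' : X'' ⟶ Y''} {a : X ⟶ X'} {b : Y ⟶ Y'} (h : f ≫ b = a ≫ f') {a' : X' ⟶ X''} {b' : Y' ⟶ Y''}
    (h' : f' ≫ b' = a' ≫ f'') :
    cokernel.map f f' a b h ≫ cokernel.map f' f'' a' b' h' =
      cokernel.map f f'' (a ≫ a') (b ≫ b') (by rw [reassoc_of% h, h', Category.assoc]) := by
  ext
  simp

theorem cokernel_map_comp_cokernelToComp {f₁ : X₁ ⟶ X₂} {f₂ : X₂ ⟶ X₃} {g₁ : Y₁ ⟶ Y₂}
    {g₂ : Y₂ ⟶ Y₃} {α₁ : X₁ ⟶ Y₁} {α₂ : X₂ ⟶ Y₂} {α₃ : X₃ ⟶ Y₃} (h₁ : f₁ ≫ α₂ = α₁ ≫ g₁)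
    (h₂ : f₂ ≫ α₃ = α₂ ≫ g₂) :
    cokernel.map f₁ g₁ α₁ α₂ h₁ ≫ cokernelToComp g₁ g₂ = cokernelToComp f₁ f₂ ≫
      cokernel.map (f₁ ≫ f₂) (g₁ ≫ g₂) α₁ α₃ (by rw [Category.assoc, h₂, reassoc_of% h₁]) := by
  ext
  simp [reassoc_of% h₂]

theorem exists_comp_eq_of_comp_cokernel_eq_zero {P : C} [Projective P] {g : Y₁ ⟶ Y₂} {p : P ⟶ Y₂}
    (h : p ≫ cokernel.π g = 0) : ∃ s, s ≫ g = p :=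
  ⟨_, (ShortComplex.exact_cokernel g).liftFromProjective_comp p h⟩

theorem exists_eq_add_cokernelToComp_iff [Projective X₂] [Projective X₃] {f₁ : X₁ ⟶ X₂}
    {f₂ : X₂ ⟶ X₃} {g : Y₁ ⟶ Y₂} {a a' : cokernel f₁ ⟶ cokernel g} {α α' : X₂ ⟶ Y₂}
    (h : cokernel.π f₁ ≫ a = α ≫ cokernel.π g) (h' : cokernel.π f₁ ≫ a' = α' ≫ cokernel.π g) :
    (∃ d, a = a' + cokernelToComp f₁ f₂ ≫ d) ↔
      ∃ (s : X₂ ⟶ Y₁) (t : X₃ ⟶ Y₂), α - α' = s ≫ g + f₂ ≫ t := by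
  constructor
  · rintro ⟨d, rfl⟩
    let t : X₃ ⟶ Y₂ := Projective.factorThru (cokernel.π _ ≫ d) (cokernel.π g)
    have ht : t ≫ cokernel.π g = cokernel.π _ ≫ d := Projective.factorThru_comp _ _
    obtain ⟨s, hs⟩ := exists_comp_eq_of_comp_cokernel_eq_zero
      (g := g) (p := α - α' - f₂ ≫ t) (by
        rw [Preadditive.sub_comp, Preadditive.sub_comp, ← h, ← h', Category.assoc, ht]
        simp)
    exact ⟨s, t, by rw [hs]; abel⟩
  · rintro ⟨s, t, hst⟩
    have ht : (f₁ ≫ f₂) ≫ t ≫ cokernel.π g = 0 := by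
      have : f₁ ≫ (α - α') ≫ cokernel.π g = 0 := by
        rw [Preadditive.sub_comp, ← h, ← h', Preadditive.comp_sub]
        simp
      rwa [hst, Preadditive.add_comp, Category.assoc, Category.assoc, cokernel.condition,
        comp_zero, zero_add, ← Category.assoc f₁] at this
    refine ⟨cokernel.desc _ _ ht, (cancel_epi (cokernel.π f₁)).1 ?_⟩
    rw [h, Preadditive.comp_add, h', ← sub_eq_iff_eq_add', ← Preadditive.sub_comp]
    simp [hst]

theorem exists_chain_map [Projective X₁] [Projective X₂] [Projective X₃] {f₁ : X₁ ⟶ X₂}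
    {f₂ : X₂ ⟶ X₃} {g₁ : Y₁ ⟶ Y₂} {g₂ : Y₂ ⟶ Y₃} {a : cokernel f₁ ⟶ cokernel g₁}
    {b : cokernel (f₁ ≫ f₂) ⟶ cokernel (g₁ ≫ g₂)}
    (h : a ≫ cokernelToComp g₁ g₂ = cokernelToComp f₁ f₂ ≫ b) :
    ∃ (α₁ : X₁ ⟶ Y₁) (α₂ : X₂ ⟶ Y₂) (α₃ : X₃ ⟶ Y₃), α₁ ≫ g₁ = f₁ ≫ α₂ ∧ α₂ ≫ g₂ = f₂ ≫ α₃ ∧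
      cokernel.π f₁ ≫ a = α₂ ≫ cokernel.π g₁ ∧ cokernel.π _ ≫ b = α₃ ≫ cokernel.π _ := by
  let α₂ : X₂ ⟶ Y₂ := Projective.factorThru (cokernel.π f₁ ≫ a) (cokernel.π g₁)
  have hα₂ : α₂ ≫ cokernel.π g₁ = cokernel.π f₁ ≫ a := Projective.factorThru_comp _ _
  let α₃ : X₃ ⟶ Y₃ := Projective.factorThru (cokernel.π _ ≫ b) (cokernel.π (g₁ ≫ g₂))
  have hα₃ : α₃ ≫ cokernel.π _ = cokernel.π _ ≫ b := Projective.factorThru_comp _ _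
  have hα : α₂ ≫ g₂ ≫ cokernel.π (g₁ ≫ g₂) = f₂ ≫ α₃ ≫ cokernel.π (g₁ ≫ g₂) :=
    calc α₂ ≫ g₂ ≫ cokernel.π (g₁ ≫ g₂) = (α₂ ≫ cokernel.π g₁) ≫ cokernelToComp g₁ g₂ := by simp
      _ = (cokernel.π f₁ ≫ cokernelToComp f₁ f₂) ≫ b := by
        rw [hα₂, Category.assoc, h, Category.assoc]
      _ = f₂ ≫ α₃ ≫ cokernel.π (g₁ ≫ g₂) := by rw [hα₃, cokernel.π_desc, Category.assoc]
  -- The lifts commute with `f₂` and `g₂` only up to `s ≫ g₁ ≫ g₂`, hence the correction of `α₂`.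
  obtain ⟨s, hs⟩ := exists_comp_eq_of_comp_cokernel_eq_zero (g := g₁ ≫ g₂)
    (p := α₂ ≫ g₂ - f₂ ≫ α₃) (by simp [Preadditive.sub_comp, hα])
  have h₂ : (α₂ - s ≫ g₁) ≫ cokernel.π g₁ = cokernel.π f₁ ≫ a := by simp [Preadditive.sub_comp, hα₂]
  obtain ⟨α₁, hα₁⟩ := exists_comp_eq_of_comp_cokernel_eq_zero
    (g := g₁) (p := f₁ ≫ (α₂ - s ≫ g₁)) (by
      rw [Category.assoc, h₂, cokernel.condition_assoc, zero_comp])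
  refine ⟨α₁, α₂ - s ≫ g₁, α₃, hα₁, ?_, h₂.symm, hα₃.symm⟩
  rw [Preadditive.sub_comp, Category.assoc, hs, sub_sub_cancel]

theorem exact_of_isPushout {X Y : C} {u : X₁ ⟶ X₂} {v : X₂ ⟶ X₃} {a : X₂ ⟶ X} {f : X ⟶ Y}
    {q : X₃ ⟶ Y} {w : u ≫ a = 0} (h : (ShortComplex.mk u a w).Exact) [Epi a]
    (sq : IsPushout v a q f) :
    (ShortComplex.mk (u ≫ v) q (by simp [sq.w, reassoc_of% w])).Exact := by
  refine ShortComplex.exact_of_g_is_cokernel _ (CokernelCofork.IsColimit.ofπ _ _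
    (fun k hk => sq.desc k (h.desc (v ≫ k) (by simpa using hk)) (h.g_desc _ _).symm)
    (fun _ _ => sq.inl_desc _ _ _) fun k hk d hd => sq.hom_ext ?_ ?_)
  · rw [hd, sq.inl_desc]
  · rw [sq.inr_desc, ← cancel_epi a]
    exact (sq.w_assoc _).symm.trans ((congrArg (v ≫ ·) hd).trans (h.g_desc _ _).symm)

end Projectives

section AdelmanEquivalence

variable {A : Type u} [Ring A]

/-- The cokernel of a morphism of free modules, as a finitely presented module. -/
noncomputable def freeCokernel {m n : ℕ} (f : freeModule A m ⟶ freeModule A n) : FPMod A where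
  obj := cokernel f
  property := (isFinPres A).prop_cokernel f
    (inferInstanceAs (Module.FinitePresentation Aᵐᵒᵖ (Fin m → A)))
    (inferInstanceAs (Module.FinitePresentation Aᵐᵒᵖ (Fin n → A)))

theorem Chain.hom_comm₁ {T T' : Chain (FreeMod A)} (α : T ⟶ T') :
    T.f₁.hom ≫ α.α₂.hom = α.α₁.hom ≫ T'.f₁.hom :=
  congrArg (·.hom) α.comm₁.symm

theorem Chain.hom_comm₂ {T T' : Chain (FreeMod A)} (α : T ⟶ T') :
    T.f₂.hom ≫ α.α₃.hom = α.α₂.hom ≫ T'.f₂.hom :=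
  congrArg (·.hom) α.comm₂.symm

theorem Chain.hom_comm₁₂ {T T' : Chain (FreeMod A)} (α : T ⟶ T') :
    (T.f₁.hom ≫ T.f₂.hom) ≫ α.α₃.hom = α.α₁.hom ≫ T'.f₁.hom ≫ T'.f₂.hom := by
  rw [Category.assoc, hom_comm₂, reassoc_of% hom_comm₁]

variable (A)

/-- The functor sending a chain `A^n ⟶ A^m ⟶ A^p` with maps `u` and `v` to the morphism
`Coker u ⟶ Coker (v u)` induced by `v`. -/
noncomputable def chainArrow : Chain (FreeMod A) ⥤ Arrow (FPMod A) where
  obj T := Arrow.mk (X := freeCokernel T.f₁.hom) (Y := freeCokernel (T.f₁.hom ≫ T.f₂.hom))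
    (ObjectProperty.homMk (cokernelToComp T.f₁.hom T.f₂.hom))
  map α := Arrow.homMk
    (ObjectProperty.homMk (cokernel.map _ _ α.α₁.hom α.α₂.hom (Chain.hom_comm₁ α)))
    (ObjectProperty.homMk (cokernel.map _ _ α.α₁.hom α.α₃.hom (Chain.hom_comm₁₂ α)))
    (ObjectProperty.hom_ext _
      (cokernel_map_comp_cokernelToComp (Chain.hom_comm₁ α) (Chain.hom_comm₂ α)))
  map_id T := Arrow.hom_ext _ _
    (ObjectProperty.hom_ext _ (cokernel.map_id T.f₁.hom (𝟙 _) (Chain.hom_comm₁ (𝟙 T))))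
    (ObjectProperty.hom_ext _
      (cokernel.map_id (T.f₁.hom ≫ T.f₂.hom) (𝟙 _) (Chain.hom_comm₁₂ (𝟙 T))))
  map_comp α β := Arrow.hom_ext _ _
    (ObjectProperty.hom_ext _
      (cokernel_map_comp_cokernel_map (Chain.hom_comm₁ α) (Chain.hom_comm₁ β)).symm)
    (ObjectProperty.hom_ext _
      (cokernel_map_comp_cokernel_map (Chain.hom_comm₁₂ α) (Chain.hom_comm₁₂ β)).symm)

variable {A} in
theorem π_comp_chainArrow_map_left {T T' : Chain (FreeMod A)} (α : T ⟶ T') :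
    cokernel.π T.f₁.hom ≫ ((chainArrow A).map α).left.hom = α.α₂.hom ≫ cokernel.π T'.f₁.hom :=
  cokernel.π_desc _ _ _

instance : (chainArrow A).Full where
  map_surjective {T T'} s := by
    have hs : s.left.hom ≫ cokernelToComp T'.f₁.hom T'.f₂.hom =
        cokernelToComp T.f₁.hom T.f₂.hom ≫ s.right.hom := congrArg (·.hom) s.w
    obtain ⟨α₁, α₂, α₃, h₁, h₂, hl, hr⟩ := exists_chain_map hs
    refine ⟨⟨⟨α₁⟩, ⟨α₂⟩, ⟨α₃⟩, InducedCategory.hom_ext h₁, InducedCategory.hom_ext h₂⟩,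
      Arrow.hom_ext _ _ (ObjectProperty.hom_ext _ ?_) (ObjectProperty.hom_ext _ ?_)⟩
    · exact (cancel_epi (cokernel.π T.f₁.hom)).1 ((cokernel.π_desc _ _ _).trans hl.symm)
    · exact (cancel_epi (cokernel.π (T.f₁.hom ≫ T.f₂.hom))).1
        ((cokernel.π_desc _ _ _).trans hr.symm)

/-- The functor sending a morphism of finitely presented modules to the finitely presented functor
it presents. -/
noncomputable def finPresFunctorOfArrow : Arrow (FPMod A) ⥤ (FPFun A)ᵒᵖ :=
  ((isFinPresFunctor A).lift (cokernelHomFunctor (FPMod A)) fun f =>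
    isFinPresFunctor_cokernelHom A f.unop.hom).rightOp

instance : (finPresFunctorOfArrow A).Full where
  map_surjective φ := by
    obtain ⟨s, hs⟩ := (cokernelHomFunctor (FPMod A)).map_surjective φ.unop.hom
    exact ⟨s.unop, Quiver.Hom.unop_inj (ObjectProperty.hom_ext _ hs)⟩

theorem homotopic_iff {T T' : Chain (FreeMod A)} (α β : T ⟶ T') :
    Chain.homotopic (FreeMod A) α β ↔ (finPresFunctorOfArrow A).map ((chainArrow A).map α) =
      (finPresFunctorOfArrow A).map ((chainArrow A).map β) := by
  trans (cokernelHomFunctor (FPMod A)).map ((chainArrow A).map α).op =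
    (cokernelHomFunctor (FPMod A)).map ((chainArrow A).map β).op
  · rw [Chain.homotopic_iff, cokernelHomFunctor_map_eq_iff]
    have := exists_eq_add_cokernelToComp_iff (f₂ := T.f₂.hom) (π_comp_chainArrow_map_left α)
      (π_comp_chainArrow_map_left β)
    constructor
    · rintro ⟨s, t, h⟩
      obtain ⟨d, hd⟩ := this.2 ⟨s.hom, t.hom, congrArg (·.hom) h⟩
      exact ⟨ObjectProperty.homMk d, ObjectProperty.hom_ext _ hd⟩
    · rintro ⟨d, h⟩
      obtain ⟨s, t, hst⟩ := this.1 ⟨d.hom, congrArg (·.hom) h⟩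
      exact ⟨⟨s⟩, ⟨t⟩, InducedCategory.hom_ext hst⟩
  · exact ⟨fun h => Quiver.Hom.unop_inj (ObjectProperty.hom_ext _ h),
      fun h => congrArg (·.unop.hom) h⟩

/-- The functor sending a chain `A^n ⟶ A^m ⟶ A^p` with maps `u` and `v` to the functor presented by
the morphism `Coker u ⟶ Coker (v u)`. -/
noncomputable def adelmanFunctor : Adelman (FreeMod A) ⥤ (FPFun A)ᵒᵖ :=
  CategoryTheory.Quotient.lift _ (chainArrow A ⋙ finPresFunctorOfArrow A) fun _ _ α β =>
    (homotopic_iff A α β).1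

instance : (adelmanFunctor A).Faithful where
  map_injective {T T'} α β h := by
    obtain ⟨α, rfl⟩ := (CategoryTheory.Quotient.functor _).map_surjective α
    obtain ⟨β, rfl⟩ := (CategoryTheory.Quotient.functor _).map_surjective β
    exact CategoryTheory.Quotient.sound _ ((homotopic_iff A α β).2 h)

instance : (adelmanFunctor A).Full where
  map_surjective φ := by
    obtain ⟨α, rfl⟩ := (chainArrow A ⋙ finPresFunctorOfArrow A).map_surjective φ
    exact ⟨(CategoryTheory.Quotient.functor _).map α, rfl⟩

theorem exists_chainArrow_iso (f : Arrow (FPMod A)) :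
    ∃ T, Nonempty ((chainArrow A).obj T ≅ f) := by
  have : Module.FinitePresentation Aᵐᵒᵖ f.left.obj := f.left.property
  have : Module.FinitePresentation Aᵐᵒᵖ f.right.obj := f.right.property
  obtain ⟨m, p, v, a, q, _, sq⟩ := exists_isPushout_freeModule f.hom.hom
  obtain ⟨n, u, w, h⟩ := exists_freeModule_exact a
  have : Epi q := sq.epi_inl_of_epi
  have h' := exact_of_isPushout h sq
  let i := (cokernelIsCokernel u).coconePointUniqueUpToIso h.gIsCokernel
  let j := (cokernelIsCokernel (u ≫ v)).coconePointUniqueUpToIso h'.gIsCokernel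
  have hi : cokernel.π u ≫ i.hom = a :=
    (cokernelIsCokernel u).comp_coconePointUniqueUpToIso_hom h.gIsCokernel .one
  have hj : cokernel.π (u ≫ v) ≫ j.hom = q :=
    (cokernelIsCokernel (u ≫ v)).comp_coconePointUniqueUpToIso_hom h'.gIsCokernel .one
  have hij : i.hom ≫ f.hom.hom = cokernelToComp u v ≫ j.hom := by
    rw [← cancel_epi (cokernel.π u), reassoc_of% hi, cokernel.π_desc_assoc, Category.assoc,
      hj, sq.w]
  exact ⟨⟨n, m, p, ⟨u⟩, ⟨v⟩⟩, ⟨Arrow.isoMk ((isFinPres A).isoMk i) ((isFinPres A).isoMk j)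
    (ObjectProperty.hom_ext _ hij)⟩⟩

instance : (adelmanFunctor A).EssSurj where
  mem_essImage F := by
    obtain ⟨_, X, Y, f, e, h⟩ := (isFinPresFunctor_iff F.unop.obj).1 F.unop.property
    obtain ⟨i⟩ := h.nonempty_iso
    obtain ⟨T, ⟨j⟩⟩ := exists_chainArrow_iso A (Arrow.mk f)
    exact ⟨(Quotient.functor _).obj T, ⟨(finPresFunctorOfArrow A).mapIso j ≪≫
      ((isFinPresFunctor A).isoMk i).symm.op⟩⟩

instance : (adelmanFunctor A).IsEquivalence where

end AdelmanEquivalence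

section Separation

open ObjectProperty in
theorem exists_exact_functor_isZero_iff_of_small {B : Type w} [Category.{w} B] [Abelian B]
    (S : ObjectProperty B) [S.IsSerreClass] :
    ∃ E : B ⥤ AddCommGrpCat.{w}, PreservesFiniteLimits E ∧ PreservesFiniteColimits E ∧
      ∀ X, IsZero (E.obj X) ↔ S X := by
  let Q := S.isoModSerre.Q
  let := SerreClassLocalization.abelian Q S
  have := SerreClassLocalization.preservesFiniteLimits Q S
  have := SerreClassLocalization.preservesFiniteColimits Q S
  let E := CategoryTheory.Abelian.FreydMitchell.functor S.isoModSerre.Localization ⋙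
    forget₂ _ AddCommGrpCat.{w}
  have : E.PreservesZeroMorphisms := inferInstance
  have : E.Faithful := inferInstance
  refine ⟨Q ⋙ E, inferInstance, inferInstance, fun X => ?_⟩
  rw [← SerreClassLocalization.isZero_obj_iff Q S]
  exact ⟨fun h => (IsZero.iff_id_eq_zero _).2 (E.map_injective
    (h.eq_of_src _ _)), fun h => E.map_isZero h⟩

theorem exists_exact_functor_isZero_iff {B : Type u} [Category.{v} B] [Abelian B]
    [EssentiallySmall.{w} B] (S : ObjectProperty B) [S.IsSerreClass] :
    ∃ E : B ⥤ AddCommGrpCat.{w}, PreservesFiniteLimits E ∧ PreservesFiniteColimits E ∧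
      ∀ X, IsZero (E.obj X) ↔ S X := by
  let e := equivSmallModel.{w} B
  let : Preadditive (SmallModel.{w} B) := .ofFullyFaithful e.fullyFaithfulInverse
  have : e.inverse.Additive := e.fullyFaithfulInverse.additive_ofFullyFaithful
  have : HasFiniteProducts (SmallModel.{w} B) :=
    ⟨fun _ => Adjunction.hasLimitsOfShape_of_equivalence e.inverse⟩
  let := abelianOfEquivalence e.inverse
  obtain ⟨E, _, _, hE⟩ := exists_exact_functor_isZero_iff_of_small (S.inverseImage e.inverse)
  refine ⟨e.functor ⋙ E, inferInstance, inferInstance, fun X => (hE _).trans ?_⟩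
  exact S.prop_iff_of_iso (e.unitIso.app X).symm

theorem epi_f_iff_isZero_X₃ {C : Type u} [Category.{v} C] [Abelian C] {S : ShortComplex C}
    (hS : S.Exact) [Epi S.g] : Epi S.f ↔ IsZero S.X₃ :=
  hS.epi_f_iff.trans ⟨fun h => .of_epi_eq_zero _ h, fun h => h.eq_of_tgt _ _⟩

theorem exists_injectiveAlong_iff_surjective {C : Type u} [Category.{v} C] [EssentiallySmall.{v} C]
    [HasFiniteColimits C] {D : Type w} [Category.{v} D] [HasFilteredColimitsOfSize.{v, v} D]
    (ι : C ⥤ D) [ι.Full] [ι.Faithful] [∀ X, IsFinitelyPresentable.{v} (ι.obj X)]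
    (G : Cᵒᵖ ⥤ Type v) [PreservesFiniteLimits G] :
    ∃ M : D, ∀ ⦃X Y : C⦄ (f : X ⟶ Y),
      InjectiveAlong (ι.map f) M ↔ Function.Surjective (G.map f.op) := by
  have : IsFiltered (CostructuredArrow yoneda G) :=
    isFiltered_costructuredArrow_yoneda_of_preservesFiniteLimits G
  have : IsFiltered G.Elementsᵒᵖ :=
    .of_equivalence (CategoryOfElements.costructuredArrowYonedaEquivalence G).symm
  have : IsFiltered (SmallModel.{v} G.Elementsᵒᵖ) := .of_equivalence (equivSmallModel _)
  have : HasColimitsOfShape G.Elementsᵒᵖ D :=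
    hasColimitsOfShape_of_equivalence (equivSmallModel.{v} G.Elementsᵒᵖ).symm
  have : IsCardinalFiltered G.Elementsᵒᵖ Cardinal.aleph0.{v} := by
    rwa [isCardinalFiltered_aleph0_iff]
  let π := (CategoryOfElements.π G).leftOp
  let K : G.Elementsᵒᵖ ⥤ D := π ⋙ ι
  let el {X : C} (x : G.obj (.op X)) : G.Elementsᵒᵖ := .op (G.elementsMk _ x)
  refine ⟨colimit K, fun X Y f => ⟨fun hf (x : G.obj (.op X)) => ?_, fun hf g => ?_⟩⟩
  · obtain ⟨k, hk⟩ := hf (colimit.ι K (el x))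
    obtain ⟨j, h, rfl⟩ := IsCardinalPresentable.exists_hom_of_isColimit Cardinal.aleph0.{v}
      (colimit.isColimit K) k
    obtain ⟨h, rfl⟩ := ι.map_surjective h
    obtain ⟨i, a, b, hab⟩ := IsCardinalPresentable.exists_eq_of_isColimit Cardinal.aleph0.{v}
      (colimit.isColimit K) (ι.map f ≫ ι.map h) (𝟙 (K.obj (el x)))
      ((Category.assoc _ _ _).trans (hk.trans (Category.id_comp _).symm))
    let z : G.obj (.op (π.obj i)) := i.unop.2
    let p : X ⟶ π.obj i := π.map b
    have hp : p = (f ≫ h) ≫ π.map a := ι.map_injective <| by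
      rw [ι.map_comp, ι.map_comp]
      exact (hab.trans (Category.id_comp _)).symm
    have hz : G.map p.op z = x := b.unop.property
    refine ⟨G.map (h ≫ π.map a).op z, ?_⟩
    rw [← hz, hp, Category.assoc]
    exact (ConcreteCategory.congr_hom (G.map_comp _ f.op) _).symm
  · obtain ⟨⟨Z⟩, h, rfl⟩ := IsCardinalPresentable.exists_hom_of_isColimit Cardinal.aleph0.{v}
      (colimit.isColimit K) g
    obtain ⟨h, rfl⟩ := ι.map_surjective h
    obtain ⟨y, hy⟩ := hf (G.map h.op Z.2)
    let a : el (G.map h.op Z.2) ⟶ .op Z := Quiver.Hom.op ⟨h.op, rfl⟩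
    let b : el (G.map h.op Z.2) ⟶ el y := Quiver.Hom.op ⟨f.op, hy⟩
    exact ⟨colimit.ι K (el y), (colimit.w K b).trans (colimit.w K a).symm⟩

variable (A : Type u) [Ring A]

instance essentiallySmall_fpFun : EssentiallySmall.{u} (FPFun A) :=
  .mk' ((adelmanFunctor A).asEquivalence.op.trans (opOpEquivalence _)).symm

variable {A} in
theorem isFinPresFunctor_preadditiveCoyoneda (X : (FPMod A)ᵒᵖ) :
    isFinPresFunctor A (preadditiveCoyoneda.obj X) :=
  (isFinPresFunctor_iff _).2 ⟨inferInstance, X.unop, X.unop, 0, 𝟙 X.unop,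
    fun {_} x => ⟨x, Category.id_comp x⟩, fun {_} x => by
      rw [show (preadditiveCoyoneda.obj X).map x (𝟙 X.unop) = x from Category.id_comp x]
      exact ⟨fun h => ⟨0, zero_comp.trans h.symm⟩, fun ⟨t, h⟩ => h.symm.trans zero_comp⟩⟩

/-- The functor `X ↦ Hom(X, -)` into the finitely presented functors. -/
def homFunctor : (FPMod A)ᵒᵖ ⥤ FPFun A :=
  (isFinPresFunctor A).lift preadditiveCoyoneda isFinPresFunctor_preadditiveCoyoneda

instance preservesFiniteLimits_homFunctor : PreservesFiniteLimits (homFunctor A) :=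
  have : PreservesFiniteLimits (homFunctor A ⋙ (isFinPresFunctor A).ι) :=
    ⟨fun J _ _ => preservesLimitsOfShape_of_evaluation _ J fun Z =>
      inferInstanceAs (PreservesLimitsOfShape J (preadditiveYoneda.obj Z))⟩
  preservesFiniteLimits_of_reflects_of_preserves (homFunctor A) (isFinPresFunctor A).ι

variable {A}

theorem isZero_map_cokernelHom_iff {X Y : FPMod A} (f : X ⟶ Y) (E : FPFun A ⥤ AddCommGrpCat.{u})
    [PreservesFiniteLimits E] [PreservesFiniteColimits E] :
    IsZero (E.obj ⟨cokernelHom f, isFinPresFunctor_cokernelHom A f⟩) ↔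
      Function.Surjective (E.map ((homFunctor A).map f.op)) := by
  let F : FPFun A := ⟨cokernelHom f, isFinPresFunctor_cokernelHom A f⟩
  let π : (homFunctor A).obj (.op X) ⟶ F := ObjectProperty.homMk (cokernel.π _)
  let S : ShortComplex (FPFun A) :=
    .mk ((homFunctor A).map f.op) π (ObjectProperty.hom_ext _ (cokernel.condition _))
  have hS : S.Exact := (S.exact_map_iff_of_faithful (isFinPresFunctor A).ι).1
    (ShortComplex.exact_cokernel (preadditiveCoyoneda.map f.op))
  have : Epi S.g := (isFinPresFunctor A).ι.epi_of_epi_map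
    (inferInstanceAs (Epi (cokernel.π (preadditiveCoyoneda.map f.op))))
  have hE : (S.map E).Exact := hS.map E
  have : Epi (S.map E).g := inferInstanceAs (Epi (E.map S.g))
  exact (epi_f_iff_isZero_X₃ hE).symm.trans (AddCommGrpCat.epi_iff_surjective _)

theorem IsSerre.exists_vanishes_iff {S : ObjectProperty (FPFun A)} (hS : IsSerre S) :
    ∃ M : RMod A, ∀ F : FPFun A, S F ↔ Vanishes F.obj M := by
  have := (isSerre_iff S).1 hS
  obtain ⟨E, _, _, hE⟩ := exists_exact_functor_isZero_iff.{u + 1, u + 1, u} S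
  have (X : FPMod A) : IsFinitelyPresentable.{u} ((isFinPres A).ι.obj X) :=
    inferInstanceAs (IsFinitelyPresentable.{u} X.obj)
  obtain ⟨M, hM⟩ := exists_injectiveAlong_iff_surjective (isFinPres A).ι
    (homFunctor A ⋙ E ⋙ forget AddCommGrpCat.{u})
  refine ⟨M, fun F => ?_⟩
  obtain ⟨_, X, Y, f, e, h⟩ := (isFinPresFunctor_iff F.obj).1 F.property
  obtain ⟨i⟩ := h.nonempty_iso
  calc S F ↔ S ⟨cokernelHom f, isFinPresFunctor_cokernelHom A f⟩ :=
        S.prop_iff_of_iso ((isFinPresFunctor A).isoMk i.symm)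
    _ ↔ IsZero (E.obj ⟨cokernelHom f, isFinPresFunctor_cokernelHom A f⟩) := (hE _).symm
    _ ↔ Function.Surjective (E.map ((homFunctor A).map f.op)) := isZero_map_cokernelHom_iff f E
    _ ↔ InjectiveAlong f.hom M := (hM f).symm
    _ ↔ Vanishes F.obj M := h.vanishes_iff.symm

end Separation

section ReducedProducts

variable {C : Type w} [Category.{v} C] [HasProducts.{u} C] {J : Type u} [Preorder J]

/-- The direct system of the products `∏_{k ≥ j} N_k`, whose colimit is the reduced product of the
`N_k` modulo the filter of tails of `J`. -/
noncomputable def tailProducts (N : J → C) : J ⥤ C where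
  obj j := ∏ᶜ fun k : {k // j ≤ k} => N k
  map {i j} h := Pi.lift fun k : {k // j ≤ k} =>
    Pi.π (fun k : {k // i ≤ k} => N k) ⟨k, (leOfHom h).trans k.2⟩

/-- The projection `∏_{k ≥ j} N_k ⟶ N_j`. -/
noncomputable def tailProducts.π (N : J → C) (j : J) : (tailProducts N).obj j ⟶ N j :=
  Pi.π (fun k : {k // j ≤ k} => N k) ⟨j, le_rfl⟩

/-- The transformation with components `P_j ⟶ P_k ⟶ N_k` for `k ≥ j`. -/
noncomputable def tailProducts.lift {P : J ⥤ C} {N : J → C} (h : ∀ k, P.obj k ⟶ N k) :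
    P ⟶ tailProducts N where
  app j := Pi.lift fun k : {k // j ≤ k} => P.map (homOfLE k.2) ≫ h k
  naturality i j l := Pi.hom_ext _ _ fun k => by
    simp only [tailProducts, Category.assoc, limit.lift_π, Fan.mk_π_app, ← P.map_comp_assoc]
    rfl

theorem tailProducts.lift_app_π {P : J ⥤ C} {N : J → C} (h : ∀ k, P.obj k ⟶ N k) (j : J) :
    (lift h).app j ≫ π N j = h j :=
  (Pi.lift_π _ _).trans ((congrArg (· ≫ h j) (P.map_id j)).trans (Category.id_comp _))

end ReducedProducts

section Definable

variable {A : Type u} [Ring A]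

theorem exists_isColimit_finPres (M : RMod A) :
    ∃ (J : Type u) (_ : PartialOrder J) (_ : IsDirectedOrder J) (_ : Nonempty J)
      (P : J ⥤ FPMod A) (π : P ⋙ (isFinPres A).ι ⟶ (Functor.const J).obj M),
      Nonempty (IsColimit (Cocone.mk M π)) := by
  have : EssentiallySmall.{u} (CostructuredArrow (isFinPres A).ι M) :=
    have : EssentiallySmall.{u} (FPMod A) := inferInstance
    inferInstance
  let e := equivSmallModel.{u} (CostructuredArrow (isFinPres A).ι M)
  have : IsFiltered (SmallModel.{u} (CostructuredArrow (isFinPres A).ι M)) :=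
    IsFiltered.of_equivalence e
  obtain ⟨J, _, _, _, F, _⟩ := IsFiltered.exists_directed
    (SmallModel.{u} (CostructuredArrow (isFinPres A).ι M))
  exact ⟨J, _, inferInstance, inferInstance, (F ⋙ e.inverse) ⋙ CostructuredArrow.proj _ _, _,
    ⟨(Functor.Final.isColimitWhiskerEquiv (F ⋙ e.inverse) _).symm
      ((isFinPres A).ι.denseAt M)⟩⟩

instance (n : ℕ) : IsFinitelyPresentable.{u} (freeModule A n) :=
  isFinPres_le_isFinitelyPresentable A _
    (inferInstanceAs (Module.FinitePresentation Aᵐᵒᵖ (Fin n → A)))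

theorem isPureMono_map_tailProducts_lift {J : Type u} [PartialOrder J] [IsDirectedOrder J]
    [Nonempty J] {P : J ⥤ FPMod A} {c : Cocone (P ⋙ (isFinPres A).ι)} (hc : IsColimit c)
    {N : J → RMod A}
    (h : ∀ k, (P ⋙ (isFinPres A).ι).obj k ⟶ N k)
    (hh : ∀ k (Q : FPMod A) (f : P.obj k ⟶ Q) (y : Q.obj ⟶ N k), f.hom ≫ y = h k →
      ∃ z, f.hom ≫ z = c.ι.app k) :
    IsPureMono (hc.map (colimit.cocone (tailProducts N)) (tailProducts.lift h)) := by
  refine (isPureMono_iff _).2 fun m n v α β w => ?_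
  let Fm : FPMod A :=
    ⟨freeModule A m, inferInstanceAs (Module.FinitePresentation Aᵐᵒᵖ (Fin m → A))⟩
  let Fn : FPMod A :=
    ⟨freeModule A n, inferInstanceAs (Module.FinitePresentation Aᵐᵒᵖ (Fin n → A))⟩
  obtain ⟨i₁, α, rfl⟩ := IsFinitelyPresentable.exists_hom_of_isColimit hc α
  obtain ⟨i₂, β, rfl⟩ := IsFinitelyPresentable.exists_hom_of_isColimit (colimit.isColimit _) β
  obtain ⟨k, a, b, hk⟩ := IsFinitelyPresentable.exists_eq_of_isColimit
    (colimit.isColimit (tailProducts N)) (v ≫ β) (α ≫ (tailProducts.lift h).app i₁)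
    (by simpa [IsColimit.ι_map] using w)
  have sq : v ≫ β ≫ (tailProducts N).map a ≫ tailProducts.π N k =
      (α ≫ (P.map b).hom) ≫ h k := by
    rw [← tailProducts.lift_app_π h k, reassoc_of% hk, Category.assoc]
    exact congrArg (α ≫ ·) (NatTrans.naturality_assoc (tailProducts.lift h) b _).symm
  let v' : Fn ⟶ Fm := ObjectProperty.homMk v
  let α' : Fn ⟶ P.obj k := ObjectProperty.homMk (α ≫ (P.map b).hom)
  have po := (IsPushout.of_hasPushout v' α').map (isFinPres A).ι
  obtain ⟨z, hz⟩ := hh k _ (pushout.inr v' α') (po.desc _ _ sq) (po.inr_desc _ _ _)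
  refine ⟨(pushout.inl v' α').hom ≫ z, ?_⟩
  calc v ≫ (pushout.inl v' α').hom ≫ z = (α ≫ (P.map b).hom) ≫ (pushout.inr v' α').hom ≫ z :=
        po.w_assoc z
    _ = α ≫ (P.map b).hom ≫ c.ι.app k := by rw [hz, Category.assoc]
    _ = α ≫ c.ι.app i₁ := congrArg (α ≫ ·) (c.w b)

theorem IsDefinable.exists_hom_of_injectiveAlong {D : ObjectProperty (RMod A)} (hD : IsDefinable D)
    {M : RMod A} (hM : ∀ (X Y : FPMod A) (f : X ⟶ Y),
      (∀ N, D N → InjectiveAlong f.hom N) → InjectiveAlong f.hom M)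
    {X : FPMod A} (g : X.obj ⟶ M) :
    ∃ (N : RMod A) (h : X.obj ⟶ N), D N ∧
      ∀ (Y : FPMod A) (f : X ⟶ Y) (y : Y.obj ⟶ N), f.hom ≫ y = h → ∃ z, f.hom ≫ z = g := by
  have : EssentiallySmall.{u} (FPMod A) := inferInstance
  let e := equivSmallModel.{u} (FPMod A)
  -- `N` is the product, over all `f` along which `g` does not extend, of modules in `D` with a map
  -- from `X` that does not extend along `f` either.
  let I := {p : Σ Y, X ⟶ e.inverse.obj Y // ¬ ∃ z, p.2.hom ≫ z = g}
  have (i : I) : ∃ N, D N ∧ ∃ h : X.obj ⟶ N, ¬ ∃ y, i.1.2.hom ≫ y = h := by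
    by_contra! H
    exact i.2 (hM _ _ i.1.2 H g)
  choose N hN h hh using this
  have := hD.products I
  refine ⟨∏ᶜ N, Pi.lift h, D.prop_limit _ fun i => hN i.as, fun Y f y hy => ?_⟩
  by_contra hf
  have hi : ¬ ∃ z, (f ≫ e.unit.app Y).hom ≫ z = g := fun ⟨z, hz⟩ =>
    hf ⟨(e.unit.app Y).hom ≫ z, (Category.assoc _ _ _).symm.trans hz⟩
  let i : I := ⟨⟨e.functor.obj Y, f ≫ e.unit.app Y⟩, hi⟩
  have w : e.unit.app Y ≫ e.unitInv.app Y = 𝟙 Y := e.unitIso.hom_inv_id_app Y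
  refine hh i ⟨(e.unitInv.app Y).hom ≫ y ≫ Pi.π N i, ?_⟩
  calc ((f ≫ e.unit.app Y) ≫ e.unitInv.app Y).hom ≫ y ≫ Pi.π N i = f.hom ≫ y ≫ Pi.π N i := by
        rw [Category.assoc, w, Category.comp_id]
    _ = h i := by rw [reassoc_of% hy, Pi.lift_π]

theorem IsDefinable.prop_of_forall_injectiveAlong {D : ObjectProperty (RMod A)}
    (hD : IsDefinable D) {M : RMod A} (hM : ∀ (X Y : FPMod A) (f : X ⟶ Y),
      (∀ N, D N → InjectiveAlong f.hom N) → InjectiveAlong f.hom M) : D M := by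
  obtain ⟨J, _, _, _, P, π, ⟨hπ⟩⟩ := exists_isColimit_finPres M
  choose N h hN hh using fun k => hD.exists_hom_of_injectiveAlong hM (π.app k)
  have := hD.directLimits J
  have := fun j => hD.products {k : J // j ≤ k}
  exact hD.pureSubobjects _ (isPureMono_map_tailProducts_lift hπ h hh)
    (D.prop_colimit _ fun j => D.prop_limit _ fun k => hN k.as)

end Definable

section SerreTransport

variable {C : Type w} [Category.{v} C] [HasZeroMorphisms C]

theorem IsSerre.op {S : ObjectProperty C} (hS : IsSerre S) : IsSerre S.op where
  containsZero := by
    obtain ⟨Z, hZ, h⟩ := hS.containsZero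
    exact ⟨Opposite.op Z, hZ.op, h⟩
  subobjects := ⟨fun f _ h => hS.quotients.prop_of_epi f.unop h⟩
  quotients := ⟨fun f _ h => hS.subobjects.prop_of_mono f.unop h⟩
  extensions := ⟨fun hT h₁ h₃ => hS.extensions.prop_X₂_of_shortExact hT.unop h₃ h₁⟩

theorem IsSerre.inverseImage {D : Type w'} [Category.{v'} D] [HasZeroMorphisms D]
    {S : ObjectProperty D} (hS : IsSerre S) (F : C ⥤ D) [F.IsEquivalence] :
    IsSerre (S.inverseImage F) where
  containsZero := by
    obtain ⟨Z, hZ, h⟩ := hS.containsZero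
    have := hS.subobjects
    exact ⟨F.objPreimage Z, F.inv.map_isZero hZ,
      S.prop_of_iso (F.objObjPreimageIso Z).symm h⟩
  subobjects := by
    have := hS.subobjects
    infer_instance
  quotients := by
    have := hS.quotients
    infer_instance
  extensions := by
    have := hS.extensions
    infer_instance

end SerreTransport

section Correspondence

variable {A : Type u} [Ring A]

theorem IsDefinable.forall {ι : Sort*} {D : ι → ObjectProperty (RMod A)}
    (hD : ∀ i, IsDefinable (D i)) : IsDefinable fun M => ∀ i, D i M where
  products J := ⟨fun _ ⟨p⟩ i => ((hD i).products J).limitsOfShape_le _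
    ⟨{ p with prop_diag_obj := fun j => p.prop_diag_obj j i }⟩⟩
  directLimits J := ⟨fun _ ⟨p⟩ i => ((hD i).directLimits J).colimitsOfShape_le _
    ⟨{ p with prop_diag_obj := fun j => p.prop_diag_obj j i }⟩⟩
  pureSubobjects f hf hN i := (hD i).pureSubobjects f hf (hN i)

theorem isDefinable_vanishes (F : FPFun A) : IsDefinable (Vanishes F.obj) := by
  obtain ⟨_, X, Y, f, e, h⟩ := (isFinPresFunctor_iff F.obj).1 F.property
  rw [show Vanishes F.obj = InjectiveAlong f.hom from funext fun M => propext h.vanishes_iff]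
  exact isDefinable_injectiveAlong f

theorem isDefinable_kerClass (S : ObjectProperty (FPFun A)) : IsDefinable (kerClass S) := by
  have : kerClass S = fun M => ∀ F, S F → Vanishes F.obj M :=
    funext fun M => propext kerClass_iff
  rw [this]
  exact .forall fun F => .forall fun _ => isDefinable_vanishes F

theorem IsSerre.annihilator_kerClass {S : ObjectProperty (FPFun A)} (hS : IsSerre S) :
    annihilator (kerClass S) = S := by
  refine le_antisymm (fun F hF => ?_) fun F hF M hM => kerClass_iff.1 hM F hF
  obtain ⟨M, hM⟩ := hS.exists_vanishes_iff
  exact (hM F).2 (hF M (kerClass_iff.2 fun G => (hM G).1))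

theorem IsDefinable.kerClass_annihilator {D : ObjectProperty (RMod A)} (hD : IsDefinable D) :
    kerClass (annihilator D) = D := by
  refine le_antisymm (fun M hM => ?_) fun M hM => kerClass_iff.2 fun F hF => hF M hM
  refine hD.prop_of_forall_injectiveAlong fun X Y f hf => ?_
  have hp := presents_cokernelHom f
  exact hp.vanishes_iff.1 (kerClass_iff.1 hM ⟨_, isFinPresFunctor_cokernelHom A f⟩
    fun N hN => hp.vanishes_iff.2 (hf N hN))

theorem bijOn_kerClass (A : Type u) [Ring A] :
    Set.BijOn (kerClass (A := A)) {S | IsSerre S} {D | IsDefinable D} :=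
  Set.InvOn.bijOn (f' := annihilator)
    ⟨fun _ hS => IsSerre.annihilator_kerClass hS, fun _ hD => IsDefinable.kerClass_annihilator hD⟩
    (fun S _ => isDefinable_kerClass S) fun D _ => isSerre_annihilator D

theorem IsSerre.le_iff_kerClass_le {S S' : ObjectProperty (FPFun A)} (hS' : IsSerre S') :
    S ≤ S' ↔ kerClass S' ≤ kerClass S := by
  refine ⟨fun h M hM F hF => hM F (h F hF), fun h => ?_⟩
  rw [← hS'.annihilator_kerClass]
  exact fun F hF M hM => kerClass_iff.1 (h M hM) F hF

/-- The subcategory of Adelman's category corresponding to a subcategory of `mod-(mod-A)` under the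
duality `adelmanFunctor A`. -/
def adelmanClass (S : ObjectProperty (FPFun A)) : ObjectProperty (Adelman (FreeMod A)) :=
  S.op.inverseImage (adelmanFunctor A)

theorem IsSerre.adelmanClass {S : ObjectProperty (FPFun A)} (hS : IsSerre S) :
    IsSerre (adelmanClass S) :=
  hS.op.inverseImage (adelmanFunctor A)

theorem adelmanClass_le_iff {S S' : ObjectProperty (FPFun A)} [S.IsClosedUnderIsomorphisms]
    [S'.IsClosedUnderIsomorphisms] : adelmanClass S ≤ adelmanClass S' ↔ S ≤ S' := by
  refine ⟨fun h F hF => ?_, fun h T hT => h _ hT⟩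
  let i := (adelmanFunctor A).objObjPreimageIso (.op F)
  exact S'.op.prop_of_iso i (h _ (S.op.prop_of_iso i.symm hF))

theorem IsSerre.exists_adelmanClass_eq {S : ObjectProperty (Adelman (FreeMod A))} (hS : IsSerre S) :
    ∃ S' : ObjectProperty (FPFun A), IsSerre S' ∧ FreeAb.adelmanClass S' = S := by
  have := hS.subobjects
  refine ⟨S.op.inverseImage (adelmanFunctor A).inv.rightOp, hS.op.inverseImage _, ?_⟩
  ext T
  exact S.prop_iff_of_iso ((adelmanFunctor A).asEquivalence.unitIso.app T).symm

theorem omega_iff_vanishes {T : Adelman (FreeMod A)} {M : RMod A} :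
    Omega T M ↔ Vanishes ((adelmanFunctor A).obj T).unop.obj M :=
  injectiveAlong_cokernelToComp_iff.symm.trans
    (presents_cokernelHom ((chainArrow A).obj T.as).hom).vanishes_iff.symm

theorem omegaClass_adelmanClass (S : ObjectProperty (FPFun A)) [S.IsClosedUnderIsomorphisms] :
    omegaClass (adelmanClass S) = kerClass S := by
  ext M
  rw [kerClass_iff]
  refine ⟨fun h F hF => ?_, fun h T hT => omega_iff_vanishes.2 (h _ hT)⟩
  let i := (adelmanFunctor A).objObjPreimageIso (.op F)
  exact (omega_iff_vanishes.1 (h _ (S.op.prop_of_iso i.symm hF))).of_mono i.unop.hom.hom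

theorem IsSerre.le_iff_omegaClass_le {S S' : ObjectProperty (Adelman (FreeMod A))}
    (hS : IsSerre S) (hS' : IsSerre S') : S ≤ S' ↔ omegaClass S' ≤ omegaClass S := by
  obtain ⟨S, h, rfl⟩ := hS.exists_adelmanClass_eq
  obtain ⟨S', h', rfl⟩ := hS'.exists_adelmanClass_eq
  have := h.subobjects
  have := h'.subobjects
  rw [adelmanClass_le_iff, omegaClass_adelmanClass, omegaClass_adelmanClass, h'.le_iff_kerClass_le]

theorem bijOn_adelmanClass (A : Type u) [Ring A] :
    Set.BijOn (adelmanClass (A := A)) {S | IsSerre S} {S | IsSerre S} := by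
  refine ⟨fun S hS => IsSerre.adelmanClass hS, fun S hS S' hS' h => ?_,
    fun S hS => IsSerre.exists_adelmanClass_eq hS⟩
  have := IsSerre.subobjects hS
  have := IsSerre.subobjects hS'
  exact le_antisymm (adelmanClass_le_iff.1 h.le) (adelmanClass_le_iff.1 h.ge)

theorem bijOn_omegaClass (A : Type u) [Ring A] :
    Set.BijOn (omegaClass (A := A)) {S | IsSerre S} {D | IsDefinable D} := by
  have h := bijOn_adelmanClass A
  rw [← h.image_eq, ← Set.bijOn_comp_iff h.injOn]
  refine (bijOn_kerClass A).congr fun S hS => ?_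
  have := IsSerre.subobjects hS
  exact (omegaClass_adelmanClass S).symm

end Correspondence

end FreeAb

open FreeAb in
theorem proposition2p16 (A : Type u) [Ring A] :
    -- (1) `S ↦ ⋂_{F ∈ S} Ker F⃗` is a bijection from the Serre subcategories of `mod-(mod-A)`
    -- onto the definable subcategories of `Mod-A`
    Set.BijOn (kerClass (A := A)) {S | IsSerre S} {D | IsDefinable D} ∧
    -- (2) `S ↦ ⋂_{𝐀 ∈ S} Ω_𝐀` is a bijection from the Serre subcategories of Adelman's category
    -- over `𝔸` onto the definable subcategories of `Mod-A`
    Set.BijOn (omegaClass (A := A)) {S | IsSerre S} {D | IsDefinable D} ∧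
    -- (3) both bijections reverse inclusions
    (∀ S S' : ObjectProperty (FPFun A), IsSerre S → IsSerre S' →
      (S ≤ S' ↔ kerClass S' ≤ kerClass S)) ∧
    (∀ S S' : ObjectProperty (Adelman (FreeMod A)), IsSerre S → IsSerre S' →
      (S ≤ S' ↔ omegaClass S' ≤ omegaClass S)) :=
  ⟨bijOn_kerClass A, bijOn_omegaClass A, fun _ _ _ hS' => hS'.le_iff_kerClass_le,
    fun _ _ hS hS' => hS.le_iff_omegaClass_le hS'⟩
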